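/- Let $K$ be a field and let $p,q,r\in K$ be nonzero elements with fixed square roots $p^{1/2},q^{1/2},r^{1/2}\in K$. (For instance $K$ may be the field $\mathbb{Q}(p^{1/2},q^{1/2},r^{1/2})$ of rational functions in indeterminates, or $K=\mathbb{C}$.) For a monomial $x=p^aq^br^c$ with $a,b,c\in\mathbb{Z}$ put $x^{1/2}=(p^{1/2})^a(q^{1/2})^b(r^{1/2})^c$ and $$\gamma(x)=x^{1/2}-x^{-1/2}.$$ For an antisymmetric $2n\times 2n$ matrix $A$ (with zero diagonal), let $$\operatorname{Pf}A=\sum_{\pi\in X}\operatorname{sgn}(\pi)\prod_{i=1}^n A_{\pi(2i-1),\pi(2i)},$$ where $X\subset S_{2n}$ consists of one representative for each perfect matching $\{\{\pi(1),\pi(2)\},\ldots,\{\pi(2n-1),\pi(2n)\}\}$ of $\{1,\ldots,2n\}$, say the one with $\pi(2i-1)<\pi(2i)$ for all $i$ and $\pi(1)<\pi(3)<\cdots<\pi(2n-1)$. Let $n\ge 0$. Define antisymmetric $2n\times 2n$ matrices $T_5=T_5(p,q,r)$ and $T_6=T_6(p,q,r)$ with zero diagonal by setting, for $1\le i,j\le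 2n$ with $i\ne j$, $$(T_5)_{i,j}=\frac{\gamma(q^{j-i})\,\gamma(r^{j-i})}{\gamma(p^{j-i})},$$ $$(T_6)_{i,j}=\gamma(p^{j+i})\,\gamma(p^{j-i})\left(\frac{\gamma(q^{j+i})}{\gamma(p^{j+i})}-\frac{\gamma(q^{j-i})}{\gamma(p^{j-i})}\right)\left(\frac{\gamma(r^{j+i})}{\gamma(p^{j+i})}-\frac{\gamma(r^{j-i})}{\gamma(p^{j-i})}\right).$$ If $p^k\neq 1$ for $1\le k\le 2n-1$, then $$\operatorname{Pf}T_5=\frac{\prod_{1\le i<j\le n}\gamma(p^{j-i})^4\ \prod_{1\le i,j\le n}\gamma(qp^{j-i})\,\gamma(rp^{j-i})}{\prod_{1\le i<j\le 2n}\gamma(p^{j-i})}.$$ If $p^k\neq 1$ for $1\le k\le 4n-1$, then $$\operatorname{Pf}T_6=\frac{\prod_{1\le i<j\le 2n}\gamma(p^{j-i})\ \prod_{1\le i,j\le 2n+1,\ 2\mid j}\gamma(qp^{j-i})\,\gamma(rp^{j-i})}{\prod_{1\le i<j\le 2n}\gamma(p^{j+i})}.$$ -/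

import Mathlib

namespace RoundPfaffian

/-- The two positions `2i` and `2i+1` (counted from `0`) of the `i`-th pair in `Fin (2 * n)`. -/
def fstPos {n : ℕ} (i : Fin n) : Fin (2 * n) := ⟨2 * i, by omega⟩

/-- See `fstPos`. -/
def sndPos {n : ℕ} (i : Fin n) : Fin (2 * n) := ⟨2 * i + 1, by omega⟩

/-- The canonical representatives of the cosets of the wreath product `S₂ ≀ Sₙ` in `S₂ₙ`, one for
each perfect matching of a set of `2n` points: the two members of each pair are listed in
increasing order, and the pairs are listed by increasing first member. -/
def matchingPerms (n : ℕ) : Finset (Equiv.Perm (Fin (2 * n))) :=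
  Finset.univ.filter fun π =>
    (∀ i : Fin n, π (fstPos i) < π (sndPos i)) ∧
      ∀ i j : Fin n, i < j → π (fstPos i) < π (fstPos j)

/-- The Pfaffian of an antisymmetric `2n × 2n` matrix. -/
def pfaffian {K : Type*} [CommRing K] {n : ℕ} (A : Matrix (Fin (2 * n)) (Fin (2 * n)) K) : K :=
  ∑ π ∈ matchingPerms n,
    ((Equiv.Perm.sign π : ℤ) : K) * ∏ i : Fin n, A (π (fstPos i)) (π (sndPos i))

/-- The function `γ(x) = x^{1/2} - x^{-1/2}`, as a function of the square root `s = x^{1/2}`. With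
`sp ^ 2 = p` and `sq ^ 2 = q`, the element `γ(p ^ k)` is `γ (sp ^ k)` and the element `γ(q p ^ k)`
is `γ (sq * sp ^ k)`, for every integer `k`. -/
def γ {K : Type*} [Field K] (s : K) : K := s - s⁻¹

/-- The row or column number of `i : Fin m`, counted from `1`. -/
def idx {m : ℕ} (i : Fin m) : ℤ := (i : ℤ) + 1

/-- The matrix `T₅(p, q, r)` of size `2n × 2n`, where `sp, sq, sr` are the square roots of
`p, q, r`. -/
def T₅ {K : Type*} [Field K] (n : ℕ) (sp sq sr : K) : Matrix (Fin (2 * n)) (Fin (2 * n)) K :=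
  Matrix.of fun i j =>
    if i = j then 0
    else γ (sq ^ (idx j - idx i)) * γ (sr ^ (idx j - idx i)) / γ (sp ^ (idx j - idx i))

/-- The matrix `T₆(p, q, r)` of size `2n × 2n`, where `sp, sq, sr` are the square roots of
`p, q, r`. -/
def T₆ {K : Type*} [Field K] (n : ℕ) (sp sq sr : K) : Matrix (Fin (2 * n)) (Fin (2 * n)) K :=
  Matrix.of fun i j =>
    if i = j then 0
    else
      γ (sp ^ (idx j + idx i)) * γ (sp ^ (idx j - idx i)) *
        (γ (sq ^ (idx j + idx i)) / γ (sp ^ (idx j + idx i)) -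
          γ (sq ^ (idx j - idx i)) / γ (sp ^ (idx j - idx i))) *
        (γ (sr ^ (idx j + idx i)) / γ (sp ^ (idx j + idx i)) -
          γ (sr ^ (idx j - idx i)) / γ (sp ^ (idx j - idx i)))

theorem γ_zpow_sub_comm {K : Type*} [Field K] (s : K) (a b : ℤ) :
    γ (s ^ (a - b)) = -γ (s ^ (b - a)) := by
  have h : a - b = -(b - a) := by ring
  rw [h, zpow_neg]
  simp [γ]

theorem T₅_transpose {K : Type*} [Field K] (n : ℕ) (sp sq sr : K) :
    (T₅ n sp sq sr).transpose = -T₅ n sp sq sr := by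
  ext i j
  by_cases h : i = j
  · simp [T₅, h]
  · simp only [Matrix.transpose_apply, Matrix.neg_apply, T₅, Matrix.of_apply, h, Ne.symm h,
      if_false]
    rw [γ_zpow_sub_comm sq, γ_zpow_sub_comm sr, γ_zpow_sub_comm sp]
    simp [div_neg]

theorem T₆_transpose {K : Type*} [Field K] (n : ℕ) (sp sq sr : K) :
    (T₆ n sp sq sr).transpose = -T₆ n sp sq sr := by
  ext i j
  by_cases h : i = j
  · simp [T₆, h]
  · simp only [Matrix.transpose_apply, Matrix.neg_apply, T₆, Matrix.of_apply, h, Ne.symm h,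
      if_false]
    rw [γ_zpow_sub_comm sq, γ_zpow_sub_comm sr, γ_zpow_sub_comm sp, add_comm (idx i)]
    simp [neg_div_neg_eq]

end RoundPfaffian

/-!
Both Pfaffians are computed as polynomials in `q`, by identifying all of their zeros.

After a rescaling of rows and columns, which changes a Pfaffian by a known factor, the entries of
`T₅` and `T₆` are polynomials in `q` and `r`, symmetric in these two variables (`normT₅`,
`normT₆`). When `q = p ^ m` for an integer `m`, the quotients of the form `γ(q ^ k) / γ(p ^ k)`
are geometric sums, so the matrix is a sum of few antisymmetric matrices of rank two: `|m|` of them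
for `T₅` (`rank_normT₅_le`), and `|m| / 2`, rounded down, for `T₆` (`rank_normT₆_le`). A polynomial
matrix of size `2 n` whose rank drops to `2 k` at a point has a Pfaffian that vanishes there to
order at least `n - k` (`pow_dvd_pfaffian`). The zeros found in this way are those of
`∏ γ(q p ^ (j - i))`, with their multiplicities, and the degree leaves no room for others. Hence the
Pfaffian is a constant times this product, first in `q` and by symmetry in `r`, and a single special
value is left to be computed (`mul_sq_eq_of_proportional`).

For `T₅` this value is taken at `q = r = p ^ n`, where the matrix is `V J Vᵀ` with a Vandermonde
matrix `V` and an antidiagonal matrix `J` of Pfaffian `1` (`pfaffian_sq_div_sub`). For `T₆` it is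
taken at `q = r = 0`, where the rescaled matrix is that of Schur's Pfaffian
`Pf ((xⱼ - xᵢ) / (xᵢ xⱼ - 1))` at `xᵢ = p ^ i`, which is evaluated by symplectic elimination
(`pfaffian_schur`).

All of this rests on the congruence invariance `Pf (P A Pᵀ) = det P · Pf A` (`pfaffian_congruence`).
The summand of the Pfaffian depends on the perfect matching only, not on the permutation that lists
it (`matchTerm_mul`), so a sum over all permutations is a multiple of the Pfaffian and transforms by
the determinant; the multiple is cancelled for generic matrices over `ℤ`, and the identity is then
specialised.
-/

namespace RoundPfaffian

open Finset Equiv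

/-! ### Positions and the partner involution -/

/-- The positions `0, …, 2n - 1` as the disjoint union of `n` pairs; `(i, b)` is the second member
of the `i`-th pair when `b` is true. -/
def posEquiv (n : ℕ) : Fin n × Bool ≃ Fin (2 * n) where
  toFun x := cond x.2 (sndPos x.1) (fstPos x.1)
  invFun k := (⟨k / 2, by omega⟩, decide ((k : ℕ) % 2 = 1))
  left_inv := by
    rintro ⟨i, b⟩
    cases b
    · ext <;> simp [fstPos]
    · ext
      · simp only [sndPos, cond_true]; omega
      · simp [sndPos, Nat.add_mod]
  right_inv := by
    intro k
    rcases Nat.mod_two_eq_zero_or_one k with h | h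
    · ext; simp only [h, fstPos]; simp; omega
    · ext; simp only [h, sndPos]; simp; omega

@[simp] theorem posEquiv_false {n : ℕ} (i : Fin n) : posEquiv n (i, false) = fstPos i := rfl

@[simp] theorem posEquiv_true {n : ℕ} (i : Fin n) : posEquiv n (i, true) = sndPos i := rfl

@[simp] theorem posEquiv_symm_fstPos {n : ℕ} (i : Fin n) :
    (posEquiv n).symm (fstPos i) = (i, false) := (posEquiv n).symm_apply_apply (i, false)

@[simp] theorem posEquiv_symm_sndPos {n : ℕ} (i : Fin n) :
    (posEquiv n).symm (sndPos i) = (i, true) := (posEquiv n).symm_apply_apply (i, true)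

theorem prod_eq_prod_fstPos_mul_sndPos {M : Type*} [CommMonoid M] {n : ℕ} (h : Fin (2 * n) → M) :
    ∏ x, h x = ∏ i : Fin n, h (fstPos i) * h (sndPos i) := by
  rw [← (posEquiv n).prod_comp, Fintype.prod_prod_type]
  simp [mul_comm]

/-- The involution exchanging the two members of each pair of positions. -/
def partner (n : ℕ) : Perm (Fin (2 * n)) :=
  (posEquiv n).permCongr ((Equiv.refl _).prodCongr Equiv.boolNot)

theorem partner_posEquiv {n : ℕ} (i : Fin n) (b : Bool) :
    partner n (posEquiv n (i, b)) = posEquiv n (i, !b) := by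
  simp [partner, Equiv.permCongr_apply]

@[simp] theorem partner_fstPos {n : ℕ} (i : Fin n) : partner n (fstPos i) = sndPos i :=
  partner_posEquiv i false

@[simp] theorem partner_sndPos {n : ℕ} (i : Fin n) : partner n (sndPos i) = fstPos i :=
  partner_posEquiv i true

theorem partner_partner {n : ℕ} (x : Fin (2 * n)) : partner n (partner n x) = x := by
  obtain ⟨⟨i, b⟩, rfl⟩ := (posEquiv n).surjective x
  simp [partner_posEquiv]

theorem partner_ne {n : ℕ} (x : Fin (2 * n)) : partner n x ≠ x := by
  obtain ⟨⟨i, b⟩, rfl⟩ := (posEquiv n).surjective x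
  simp [partner_posEquiv]

/-! ### Perfect matchings as fixed-point-free involutions -/

/-- The perfect matching `{{σ 0, σ 1}, {σ 2, σ 3}, …}`, encoded as the fixed-point-free involution
that exchanges the two members of each pair. -/
def matching {n : ℕ} (σ : Perm (Fin (2 * n))) : Perm (Fin (2 * n)) := σ * partner n * σ⁻¹

theorem matching_apply {n : ℕ} (σ : Perm (Fin (2 * n))) (x : Fin (2 * n)) :
    matching σ (σ x) = σ (partner n x) := by simp [matching]

theorem matching_involutive {n : ℕ} (σ : Perm (Fin (2 * n))) (x : Fin (2 * n)) :
    matching σ (matching σ x) = x := by simp [matching, partner_partner]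

theorem matching_ne {n : ℕ} (σ : Perm (Fin (2 * n))) (x : Fin (2 * n)) : matching σ x ≠ x := by
  obtain ⟨y, rfl⟩ := σ.surjective x
  rw [matching_apply]
  exact fun h => partner_ne y (σ.injective h)

theorem commute_of_matching_eq {n : ℕ} {σ τ : Perm (Fin (2 * n))} (h : matching σ = matching τ) :
    (σ⁻¹ * τ) * partner n = partner n * (σ⁻¹ * τ) := by
  have h' : σ * partner n * σ⁻¹ = τ * partner n * τ⁻¹ := h
  calc (σ⁻¹ * τ) * partner n = σ⁻¹ * (τ * partner n * τ⁻¹) * τ := by group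
    _ = σ⁻¹ * (σ * partner n * σ⁻¹) * τ := by rw [h']
    _ = _ := by group

theorem matching_mul {n : ℕ} {σ w : Perm (Fin (2 * n))} (h : w * partner n = partner n * w) :
    matching (σ * w) = matching σ := by
  calc σ * w * partner n * (σ * w)⁻¹ = σ * (w * partner n) * w⁻¹ * σ⁻¹ := by group
    _ = σ * partner n * σ⁻¹ := by rw [h]; group

/-- A fixed-point-free involution has `n` pairs, and the smaller members are counted here. -/
theorem card_lt_of_involutive {n : ℕ} (m : Perm (Fin (2 * n))) (h1 : ∀ x, m (m x) = x)
    (h2 : ∀ x, m x ≠ x) : (univ.filter fun x => x < m x).card = n := by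
  have e : (univ.filter fun x => x < m x).card = (univ.filter fun x => ¬ x < m x).card := by
    refine Finset.card_bij (fun x _ => m x) ?_ ?_ ?_
    · intro x hx
      simp only [mem_filter, mem_univ, true_and] at hx ⊢
      rw [h1]; exact hx.le.not_gt
    · intro x _ y _ hxy
      exact m.injective hxy
    · intro x hx
      refine ⟨m x, ?_, h1 x⟩
      simp only [mem_filter, mem_univ, true_and] at hx ⊢
      rw [h1]; exact lt_of_le_of_ne (not_lt.mp hx) (h2 x)
  have := Finset.card_filter_add_card_filter_not (s := (univ : Finset (Fin (2 * n))))
    (fun x => x < m x)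
  rw [Finset.card_univ, Fintype.card_fin] at this
  omega

theorem mem_matchingPerms {n : ℕ} {π : Perm (Fin (2 * n))} : π ∈ matchingPerms n ↔
    (∀ i : Fin n, π (fstPos i) < π (sndPos i)) ∧
      ∀ i j : Fin n, i < j → π (fstPos i) < π (fstPos j) := by
  simp [matchingPerms]

/-- The first members listed by a canonical representative are determined by the matching: they are
the smaller members of the pairs, in increasing order. -/
theorem matchingPerms_fst_eq {n : ℕ} {π : Perm (Fin (2 * n))} (hπ : π ∈ matchingPerms n) :
    (fun i => π (fstPos i)) = (univ.filter fun x => x < matching π x).orderEmbOfFin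
      (card_lt_of_involutive _ (matching_involutive π) (matching_ne π)) := by
  rw [mem_matchingPerms] at hπ
  refine Finset.orderEmbOfFin_unique _ ?_ (fun i j hij => hπ.2 i j hij)
  intro i
  simp only [mem_filter, mem_univ, true_and, matching_apply, partner_fstPos]
  exact hπ.1 i

theorem eq_of_matching_eq {n : ℕ} {π ρ : Perm (Fin (2 * n))} (hπ : π ∈ matchingPerms n)
    (hρ : ρ ∈ matchingPerms n) (h : matching π = matching ρ) : π = ρ := by
  have h1 : ∀ i, π (fstPos i) = ρ (fstPos i) := by
    have a := matchingPerms_fst_eq hπ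
    have b := matchingPerms_fst_eq hρ
    simp only [h] at a
    exact congrFun (a.trans b.symm)
  have h2 : ∀ i, π (sndPos i) = ρ (sndPos i) := by
    intro i
    rw [← partner_fstPos, ← matching_apply, ← matching_apply, h, h1]
  ext1 x
  obtain ⟨⟨i, b⟩, rfl⟩ := (posEquiv n).surjective x
  cases b
  · exact h1 i
  · exact h2 i

/-- Together with the uniqueness in `eq_of_matching_eq`, this says that
`matchingPerms n` contains exactly one representative of each matching. -/
theorem exists_mem_matchingPerms {n : ℕ} (σ : Perm (Fin (2 * n))) :
    ∃ π ∈ matchingPerms n, matching π = matching σ := by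
  set m := matching σ with hm
  have hc := card_lt_of_involutive m (matching_involutive σ) (matching_ne σ)
  set s := (univ.filter fun x => x < m x).orderEmbOfFin hc with hs
  have hlt : ∀ i, s i < m (s i) := fun i => by
    have := Finset.orderEmbOfFin_mem _ hc i
    rw [mem_filter] at this
    exact this.2
  let τ : Fin n × Bool → Fin (2 * n) := fun x => cond x.2 (m (s x.1)) (s x.1)
  have hτ : Function.Injective τ := by
    rintro ⟨i, a⟩ ⟨j, b⟩ hab
    have key : ∀ i j, m (s i) ≠ s j := by
      intro i j hij
      have h1 := hlt j
      rw [← hij, matching_involutive] at h1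
      exact absurd (hlt i) h1.not_gt
    cases a <;> cases b <;> simp only [τ, cond_true, cond_false] at hab
    · rw [s.injective hab]
    · exact absurd hab.symm (key _ _)
    · exact absurd hab (key _ _)
    · rw [s.injective (m.injective hab)]
  have hτb : Function.Bijective τ := by
    rw [Fintype.bijective_iff_injective_and_card]
    refine ⟨hτ, ?_⟩
    simp [mul_comm]
  let π : Perm (Fin (2 * n)) := (posEquiv n).symm.trans (Equiv.ofBijective τ hτb)
  have hf : ∀ i, π (fstPos i) = s i := fun i => by
    rw [← posEquiv_false]; simp [π, τ, -posEquiv_false]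
  have hg : ∀ i, π (sndPos i) = m (s i) := fun i => by
    rw [← posEquiv_true]; simp [π, τ, -posEquiv_true]
  refine ⟨π, ?_, ?_⟩
  · rw [mem_matchingPerms]
    refine ⟨fun i => ?_, fun i j hij => ?_⟩
    · rw [hf, hg]; exact hlt i
    · rw [hf, hf]; exact s.strictMono hij
  · ext1 y
    obtain ⟨x, rfl⟩ := π.surjective y
    rw [matching_apply]
    obtain ⟨⟨i, b⟩, rfl⟩ := (posEquiv n).surjective x
    cases b
    · simp [hf, hg]
    · simp [hf, hg, hm, matching_involutive]

/-! ### Invariance of the Pfaffian summand -/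

/-- The summand of the Pfaffian, at an arbitrary permutation. -/
def matchTerm {K : Type*} [CommRing K] {n : ℕ} (A : Matrix (Fin (2 * n)) (Fin (2 * n)) K)
    (σ : Perm (Fin (2 * n))) : K :=
  ((Perm.sign σ : ℤ) : K) * ∏ i : Fin n, A (σ (fstPos i)) (σ (sndPos i))

/-- The summand of the Pfaffian of an antisymmetric matrix depends on the matching only: permuting
the pairs is an even permutation, and each flip of a pair changes both the sign of the permutation
and the sign of one factor. -/
theorem matchTerm_mul {K : Type*} [CommRing K] {n : ℕ} {A : Matrix (Fin (2 * n)) (Fin (2 * n)) K}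
    (hA : ∀ i j, A j i = -A i j) {w : Perm (Fin (2 * n))} (hw : w * partner n = partner n * w)
    (σ : Perm (Fin (2 * n))) : matchTerm A (σ * w) = matchTerm A σ := by
  have hw' : ∀ x, w (partner n x) = partner n (w x) := fun x => Perm.ext_iff.mp hw x
  -- In terms of pairs, `w` sends `(i, b)` to `(e i, b)`, or to `(e i, !b)` if `c i` holds.
  let v : Perm (Fin n × Bool) := (posEquiv n).symm.permCongr w
  have hv : ∀ x, posEquiv n (v x) = w (posEquiv n x) := fun x => by
    simp [v, Equiv.permCongr_apply]
  let e : Fin n → Fin n := fun i => (v (i, false)).1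
  let c : Fin n → Bool := fun i => (v (i, false)).2
  have hv0 : ∀ i, v (i, false) = (e i, c i) := fun i => rfl
  have hv1 : ∀ i, v (i, true) = (e i, !c i) := fun i => by
    apply (posEquiv n).injective
    rw [hv, ← partner_posEquiv, ← hv0, hv, ← hw', partner_posEquiv]; rfl
  have he : Function.Injective e := by
    intro i j hij
    by_cases hc : c i = c j
    · have : v (i, false) = v (j, false) := by rw [hv0, hv0, hij, hc]
      simpa using v.injective this
    · have : v (i, false) = v (j, true) := by
        rw [hv0, hv1, hij]
        congr 1
        cases h1 : c i <;> cases h2 : c j <;> simp_all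
      simpa using v.injective this
  let E : Perm (Fin n) := Equiv.ofBijective e (Finite.injective_iff_bijective.mp he)
  have hE : ∀ i, E i = e i := fun i => rfl
  have hvE : v = Equiv.prodCongrLeft (fun _ : Bool => E) *
      Equiv.prodCongrRight (fun i => if c i then Equiv.boolNot else 1) := by
    ext1 ⟨i, b⟩
    cases b
    · rw [hv0]
      cases h : c i <;> simp [Equiv.prodCongrLeft, Equiv.prodCongrRight, h, hE]
    · rw [hv1]
      cases h : c i <;> simp [Equiv.prodCongrLeft, Equiv.prodCongrRight, h, hE]
  have hbn : Perm.sign Equiv.boolNot = -1 := by decide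
  have hs : Perm.sign w = ∏ i, if c i then -1 else 1 := by
    rw [← Perm.sign_permCongr (posEquiv n).symm w]
    change Perm.sign v = _
    rw [hvE, Perm.sign_mul, Perm.sign_prodCongrLeft, Perm.sign_prodCongrRight]
    simp only [Finset.prod_const, Finset.card_univ, Fintype.card_bool, Int.units_sq, one_mul]
    refine Finset.prod_congr rfl fun i _ => ?_
    split_ifs
    · exact hbn
    · exact Perm.sign_one
  have hp : ∀ i, A ((σ * w) (fstPos i)) ((σ * w) (sndPos i)) =
      (if c i then -1 else 1) * A (σ (fstPos (E i))) (σ (sndPos (E i))) := by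
    intro i
    rw [Perm.mul_apply, Perm.mul_apply, ← posEquiv_false, ← posEquiv_true, ← hv, ← hv, hv0, hv1, hE]
    cases h : c i
    · simp
    · simp [hA (σ (fstPos (e i)))]
  unfold matchTerm
  simp only [hp]
  rw [Finset.prod_mul_distrib, Equiv.prod_comp E (fun i => A (σ (fstPos i)) (σ (sndPos i))),
    Perm.sign_mul, hs]
  have h2 : (((∏ i, if c i then (-1 : ℤˣ) else 1 : ℤˣ) : ℤ) : K) = ∏ i, if c i then -1 else 1 := by
    push_cast
    refine Finset.prod_congr rfl fun i _ => ?_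
    split_ifs <;> simp
  have h3 : (∏ i, if c i then (-1 : K) else 1) * (∏ i, if c i then (-1 : K) else 1) = 1 := by
    rw [← Finset.prod_mul_distrib]
    refine Finset.prod_eq_one fun i _ => ?_
    split_ifs <;> simp
  rw [Units.val_mul, Int.cast_mul, h2]
  linear_combination ((Perm.sign σ : ℤ) : K) * (∏ i, A (σ (fstPos i)) (σ (sndPos i))) * h3

/-! ### Congruence invariance of the Pfaffian -/

theorem congruence_antisymm {K : Type*} [CommRing K] {N : ℕ} (P : Matrix (Fin N) (Fin N) K)
    {A : Matrix (Fin N) (Fin N) K} (hA : ∀ i j, A j i = -A i j) (i j : Fin N) :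
    (P * A * P.transpose) j i = -(P * A * P.transpose) i j := by
  have hT : A.transpose = -A := by ext i j; simp [hA i j]
  have h : (P * A * P.transpose).transpose = -(P * A * P.transpose) := by
    rw [Matrix.transpose_mul, Matrix.transpose_mul, Matrix.transpose_transpose, hT]
    simp [Matrix.mul_assoc]
  exact congrFun (congrFun h i) j

theorem pfaffian_eq_sum_matchTerm {K : Type*} [CommRing K] {n : ℕ}
    (A : Matrix (Fin (2 * n)) (Fin (2 * n)) K) :
    pfaffian A = ∑ π ∈ matchingPerms n, matchTerm A π := rfl

theorem map_pfaffian {R S : Type*} [CommRing R] [CommRing S] (f : R →+* S) {n : ℕ}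
    (A : Matrix (Fin (2 * n)) (Fin (2 * n)) R) : f (pfaffian A) = pfaffian (A.map f) := by
  simp [pfaffian, map_sum, map_prod]

/-- Summing over all permutations instead of over the matchings multiplies the Pfaffian of an
antisymmetric matrix by the order of the wreath product `S₂ ≀ Sₙ`, the centralizer of
`partner n`. -/
theorem sum_matchTerm {K : Type*} [CommRing K] {n : ℕ} {A : Matrix (Fin (2 * n)) (Fin (2 * n)) K}
    (hA : ∀ i j, A j i = -A i j) :
    ∑ σ, matchTerm A σ =
      (univ.filter fun w => w * partner n = partner n * w).card * pfaffian A := by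
  choose rep hrep hmatch using fun σ : Perm (Fin (2 * n)) => exists_mem_matchingPerms σ
  rw [pfaffian_eq_sum_matchTerm, Finset.mul_sum,
    ← Finset.sum_fiberwise_of_maps_to (g := rep) (t := matchingPerms n) (fun σ _ => hrep σ)]
  refine Finset.sum_congr rfl fun π hπ => ?_
  have h1 : ∀ σ ∈ univ.filter (fun σ => rep σ = π), matchTerm A σ = matchTerm A π := by
    intro σ hσ
    rw [mem_filter] at hσ
    have hm : matching π = matching σ := by rw [← hσ.2, hmatch]
    rw [← matchTerm_mul hA (commute_of_matching_eq hm) π, mul_inv_cancel_left]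
  rw [Finset.sum_congr rfl h1, Finset.sum_const, nsmul_eq_mul]
  congr 2
  refine Finset.card_nbij' (fun σ => π⁻¹ * σ) (fun w => π * w) ?_ ?_ ?_ ?_
  · intro σ hσ
    simp only [coe_filter, mem_univ, true_and, Set.mem_ofPred_eq] at hσ ⊢
    exact commute_of_matching_eq (by rw [← hσ, hmatch])
  · intro w hw
    simp only [coe_filter, mem_univ, true_and, Set.mem_ofPred_eq] at hw ⊢
    exact eq_of_matching_eq (hrep _) hπ (by rw [hmatch, matching_mul hw])
  · intro σ _; simp
  · intro w _; simp

/-- The values at the pairs of positions, joined to one function of the position. -/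
def unpair {n : ℕ} {α : Type*} : (Fin n → α × α) ≃ (Fin (2 * n) → α) where
  toFun g x := cond ((posEquiv n).symm x).2 (g ((posEquiv n).symm x).1).2
    (g ((posEquiv n).symm x).1).1
  invFun G i := (G (fstPos i), G (sndPos i))
  left_inv g := by
    ext i <;> simp
  right_inv G := by
    ext x
    obtain ⟨⟨i, b⟩, rfl⟩ := (posEquiv n).surjective x
    cases b <;> simp

/-- The expansion of the left side runs over functions `G` that choose the summation indices; as in
the proof of the multiplicativity of the determinant, only bijective `G` contribute. -/
theorem sum_matchTerm_congruence {K : Type*} [CommRing K] {n : ℕ}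
    (P A : Matrix (Fin (2 * n)) (Fin (2 * n)) K) :
    ∑ σ, matchTerm (P * A * P.transpose) σ = P.det * ∑ σ, matchTerm A σ := by
  have expand : ∀ a b, (P * A * P.transpose) a b =
      ∑ kl : Fin (2 * n) × Fin (2 * n), P a kl.1 * P b kl.2 * A kl.1 kl.2 := by
    intro a b
    rw [Fintype.sum_prod_type_right, Matrix.mul_apply]
    refine Finset.sum_congr rfl fun l _ => ?_
    rw [Matrix.mul_apply, Finset.sum_mul]
    refine Finset.sum_congr rfl fun k _ => ?_
    rw [Matrix.transpose_apply]; ring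
  calc ∑ σ, matchTerm (P * A * P.transpose) σ
      = ∑ σ : Perm (Fin (2 * n)), ((Perm.sign σ : ℤ) : K) * ∑ G : Fin (2 * n) → Fin (2 * n),
          (∏ x, P (σ x) (G x)) * ∏ i, A (G (fstPos i)) (G (sndPos i)) := by
        refine Finset.sum_congr rfl fun σ _ => ?_
        unfold matchTerm
        congr 1
        simp only [expand, Finset.prod_univ_sum, Fintype.piFinset_univ]
        refine Fintype.sum_equiv unpair _ _ fun g => ?_
        rw [prod_eq_prod_fstPos_mul_sndPos, ← Finset.prod_mul_distrib]
        refine Finset.prod_congr rfl fun i _ => ?_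
        have h : g i = (unpair g (fstPos i), unpair g (sndPos i)) :=
          (congrFun (unpair.left_inv g) i).symm
        rw [h]
    _ = ∑ G : Fin (2 * n) → Fin (2 * n), (P.submatrix id G).det *
          ∏ i, A (G (fstPos i)) (G (sndPos i)) := by
        simp only [Finset.mul_sum]
        rw [Finset.sum_comm]
        refine Finset.sum_congr rfl fun G _ => ?_
        rw [Matrix.det_apply', Finset.sum_mul]
        refine Finset.sum_congr rfl fun σ _ => ?_
        simp [mul_assoc]
    _ = ∑ G : Fin (2 * n) → Fin (2 * n) with Function.Bijective G, (P.submatrix id G).det *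
          ∏ i, A (G (fstPos i)) (G (sndPos i)) := by
        refine (sum_subset (filter_subset _ _) fun G _ hG => ?_).symm
        have hG' : ¬ Function.Injective G := by
          rw [Finite.injective_iff_bijective]; simpa using hG
        obtain ⟨i, j, hij, hne⟩ : ∃ i j, G i = G j ∧ i ≠ j := by
          simpa [Function.Injective] using hG'
        rw [Matrix.det_zero_of_column_eq hne (fun k => by simp [hij]), zero_mul]
    _ = ∑ τ : Perm (Fin (2 * n)), (P.submatrix id τ).det *
          ∏ i, A (τ (fstPos i)) (τ (sndPos i)) :=
        sum_bij (fun p h => Equiv.ofBijective p (mem_filter.1 h).2) (fun _ _ => mem_univ _)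
          (fun _ _ _ _ h => by injection h)
          (fun b _ => ⟨b, mem_filter.2 ⟨mem_univ _, b.bijective⟩, coe_fn_injective rfl⟩)
          fun _ _ => rfl
    _ = P.det * ∑ σ, matchTerm A σ := by
        rw [Finset.mul_sum]
        refine Finset.sum_congr rfl fun τ _ => ?_
        rw [Matrix.det_permute', matchTerm]; ring

/-- In characteristic zero, congruence invariance of the Pfaffian follows by cancelling the
multiplicity in `sum_matchTerm`. -/
theorem pfaffian_congruence_of_charZero {K : Type*} [CommRing K] [IsDomain K] [CharZero K] {n : ℕ}
    (P : Matrix (Fin (2 * n)) (Fin (2 * n)) K) {A : Matrix (Fin (2 * n)) (Fin (2 * n)) K}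
    (hA : ∀ i j, A j i = -A i j) :
    pfaffian (P * A * P.transpose) = P.det * pfaffian A := by
  have h := sum_matchTerm_congruence P A
  rw [sum_matchTerm hA, sum_matchTerm (congruence_antisymm P hA)] at h
  have hc : ((univ.filter fun w => w * partner n = partner n * w).card : K) ≠ 0 := by
    rw [Nat.cast_ne_zero]
    exact Finset.card_ne_zero_of_mem (a := 1) (by simp)
  refine mul_left_cancel₀ hc ?_
  rw [h]; ring

/-- The Pfaffian of an alternating matrix over any commutative ring is multiplied by `det P` under
the congruence `A ↦ P A Pᵀ`. The identity holds for generic matrices over `ℤ`, hence always. -/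
theorem pfaffian_congruence {K : Type*} [CommRing K] {n : ℕ}
    (P : Matrix (Fin (2 * n)) (Fin (2 * n)) K) {A : Matrix (Fin (2 * n)) (Fin (2 * n)) K}
    (hA : ∀ i j, A j i = -A i j) (h0 : ∀ i, A i i = 0) :
    pfaffian (P * A * P.transpose) = P.det * pfaffian A := by
  let I := Fin (2 * n) × Fin (2 * n)
  let R := MvPolynomial (I ⊕ I) ℤ
  let P' : Matrix (Fin (2 * n)) (Fin (2 * n)) R := Matrix.of fun i j => MvPolynomial.X (.inl (i, j))
  let A' : Matrix (Fin (2 * n)) (Fin (2 * n)) R := Matrix.of fun i j =>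
    MvPolynomial.X (.inr (i, j)) - MvPolynomial.X (.inr (j, i))
  -- `A' = B - Bᵀ` for a generic `B`, which is specialised to the upper triangular part of `A`.
  let f : R →+* K := MvPolynomial.eval₂Hom (Int.castRingHom K)
    (Sum.elim (fun x => P x.1 x.2) (fun x => if x.1 < x.2 then A x.1 x.2 else 0))
  have hf : ∀ x, f (MvPolynomial.X x) = Sum.elim (fun x => P x.1 x.2)
      (fun x => if x.1 < x.2 then A x.1 x.2 else 0) x := fun x => MvPolynomial.eval₂Hom_X' _ _ _
  have hP : P'.map f = P := by
    ext i j
    simp only [P', Matrix.map_apply, Matrix.of_apply, hf, Sum.elim_inl]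
  have hAf : A'.map f = A := by
    ext i j
    simp only [A', Matrix.map_apply, Matrix.of_apply, map_sub, hf, Sum.elim_inr]
    rcases lt_trichotomy i j with h | rfl | h
    · simp [h, h.not_gt]
    · simp [h0]
    · simp [h, h.not_gt, hA j i]
  have key := pfaffian_congruence_of_charZero P' (A := A') (fun i j => by simp [A'])
  have := congrArg f key
  rw [map_mul, map_pfaffian, map_pfaffian, RingHom.map_det, hAf, Matrix.map_mul, Matrix.map_mul,
    hAf, RingHom.mapMatrix_apply, Matrix.transpose_map, hP] at this
  exact this

theorem pfaffian_diagonal_scaling {K : Type*} [CommRing K] {n : ℕ} (d : Fin (2 * n) → K)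
    (A : Matrix (Fin (2 * n)) (Fin (2 * n)) K) :
    pfaffian (Matrix.of fun i j => d i * d j * A i j) = (∏ i, d i) * pfaffian A := by
  unfold pfaffian
  rw [Finset.mul_sum]
  refine Finset.sum_congr rfl fun π _ => ?_
  rw [← Equiv.prod_comp π d, prod_eq_prod_fstPos_mul_sndPos]
  simp only [Matrix.of_apply, Finset.prod_mul_distrib]
  ring

section

open Polynomial

/-! ### Corank and order of vanishing -/

/-- A sum of `k` antisymmetric matrices of rank two has rank at most `2 * k`. -/
theorem rank_le_two_mul {K : Type*} [Field K] {N k : ℕ} {M : Matrix (Fin N) (Fin N) K}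
    (u v : Fin k → Fin N → K) (h : ∀ i j, M i j = ∑ l, (u l i * v l j - v l i * u l j)) :
    M.rank ≤ 2 * k := by
  let W₁ : Matrix (Fin N) (Fin k ⊕ Fin k) K :=
    Matrix.of fun i => Sum.elim (fun l => u l i) (fun l => -v l i)
  let W₂ : Matrix (Fin k ⊕ Fin k) (Fin N) K :=
    Matrix.of fun l j => Sum.elim (fun l => v l j) (fun l => u l j) l
  have hM : M = W₁ * W₂ := by
    ext i j
    simp [h, Matrix.mul_apply, W₁, W₂, Finset.sum_add_distrib, sub_eq_add_neg]
  rw [hM]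
  refine (Matrix.rank_mul_le_left _ _).trans ((Matrix.rank_le_card_width _).trans ?_)
  simp [two_mul]

/-- If a polynomial matrix has rank at most `2 * k` at the point `a`, then a constant congruence
makes all but `2 * k` of its rows and columns vanish at `a`, so that every summand of the Pfaffian
has at least `n - k` factors that vanish at `a`. -/
theorem pow_dvd_pfaffian {K : Type*} [Field K] {n k : ℕ}
    {A : Matrix (Fin (2 * n)) (Fin (2 * n)) K[X]}
    (hA : ∀ i j, A j i = -A i j) (h0 : ∀ i, A i i = 0) (a : K)
    (hr : (A.map (eval a)).rank ≤ 2 * k) : (X - C a) ^ (n - k) ∣ pfaffian A := by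
  set M := A.map (eval a) with hM
  obtain ⟨V, U, e, hV, hU, hVU⟩ := Matrix.exists_rank_normal_form M
  -- The rows outside `s` vanish at `a` after the congruence by `V`.
  let s : Finset (Fin (2 * n)) := univ.filter fun i => (e i).isLeft
  have hs : s.card ≤ 2 * k := by
    refine le_trans ?_ hr
    have : s.card ≤ (univ.map (Function.Embedding.inl :
        Fin M.rank ↪ Fin M.rank ⊕ Fin (Fintype.card (Fin (2 * n)) - M.rank))).card := by
      refine Finset.card_le_card_of_injOn e ?_ e.injective.injOn
      intro i hi
      have hi' : (e i).isLeft := by simpa [s] using hi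
      obtain ⟨y, hy⟩ := Sum.isLeft_iff.mp hi'
      simp [hy]
    simpa using this
  have hrow : ∀ i, i ∉ s → ∀ j, (V * M) i j = 0 := by
    intro i hi j
    have hi' : ¬ (e i).isLeft := by simpa [s] using hi
    obtain ⟨y, hy⟩ := Sum.isRight_iff.mp (by simpa using hi')
    have hz : ∀ l, (V * M * U) i l = 0 := by
      intro l
      rw [hVU, Matrix.submatrix_apply, hy]
      rcases e l with z | z <;> simp
    have hU' : IsUnit U.det := (Matrix.isUnit_iff_isUnit_det _).mp hU
    have : V * M = V * M * U * U⁻¹ := by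
      rw [Matrix.mul_assoc (V * M), Matrix.mul_nonsing_inv _ hU', Matrix.mul_one]
    rw [this, Matrix.mul_apply]
    exact Finset.sum_eq_zero fun l _ => by rw [hz, zero_mul]
  let P : Matrix (Fin (2 * n)) (Fin (2 * n)) K[X] := V.map C
  have hPev : (P * A * P.transpose).map (eval a) = V * M * V.transpose := by
    have h1 : ∀ N : Matrix (Fin (2 * n)) (Fin (2 * n)) K[X],
        N.map (eval a) = N.map (evalRingHom a) := fun N => rfl
    have h2 : P.map (evalRingHom a) = V := by ext i j; simp [P]
    rw [h1, Matrix.map_mul, Matrix.map_mul, Matrix.transpose_map, h2]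
    rfl
  have hdiv : ∀ i j, i ∉ s → X - C a ∣ (P * A * P.transpose) i j := by
    intro i j hi
    rw [dvd_iff_isRoot, IsRoot.def]
    have : eval a ((P * A * P.transpose) i j) = (V * M * V.transpose) i j := by
      rw [← hPev]; rfl
    rw [this, Matrix.mul_apply]
    exact Finset.sum_eq_zero fun l _ => by rw [hrow i hi, zero_mul]
  have hdet : IsUnit P.det := by
    have : P.det = C V.det := (RingHom.map_det C V).symm
    rw [this]
    exact ((Matrix.isUnit_iff_isUnit_det _).mp hV).map C
  rw [← hdet.dvd_mul_left, ← pfaffian_congruence P hA h0]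
  refine Finset.dvd_sum fun π _ => Dvd.dvd.mul_left ?_ _
  -- The factors with an index in `T` are those that need not vanish at `a`.
  set T : Finset (Fin n) := univ.filter fun i => π (fstPos i) ∈ s ∧ π (sndPos i) ∈ s with hT
  have hTc : 2 * T.card ≤ s.card := by
    have h1 : (T ×ˢ (univ : Finset Bool)).card ≤ s.card := by
      refine Finset.card_le_card_of_injOn (fun x => π (posEquiv n x)) ?_
        (π.injective.comp (posEquiv n).injective).injOn
      rintro ⟨i, b⟩ hx
      have hx' : i ∈ T := by simpa using hx
      rw [hT, mem_filter] at hx'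
      cases b
      · exact hx'.2.1
      · exact hx'.2.2
    rw [Finset.card_product] at h1
    simpa [mul_comm] using h1
  have h2 : (X - C a) ^ (n - k) ∣ ∏ i ∈ univ.filter (fun i => i ∉ T), (X - C a) := by
    rw [Finset.prod_const]
    refine pow_dvd_pow _ ?_
    have := Finset.card_filter_add_card_filter_not (s := (univ : Finset (Fin n))) (fun i => i ∈ T)
    rw [Finset.card_univ, Fintype.card_fin] at this
    simp only [Finset.filter_univ_mem] at this
    omega
  refine h2.trans ?_
  refine (Finset.prod_dvd_prod_of_dvd _ _ ?_).trans
    (Finset.prod_dvd_prod_of_subset _ _ _ (Finset.filter_subset _ _))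
  intro i hi
  rw [mem_filter, hT, mem_filter] at hi
  by_cases h : π (fstPos i) ∈ s
  · have h' : π (sndPos i) ∉ s := fun h' => hi.2 ⟨mem_univ _, h, h'⟩
    rw [← neg_neg ((P * A * P.transpose) _ _), ← congruence_antisymm P hA, dvd_neg]
    exact hdiv _ _ h'
  · exact hdiv _ _ h

/-- A polynomial whose degree is at most the number of its prescribed roots, counted with
multiplicity, is determined by them up to a constant factor. -/
theorem exists_eq_C_mul_prod {K : Type*} [Field K] [DecidableEq K] {P : K[X]} (s : Multiset K)
    (hdvd : ∀ a ∈ s, (X - C a) ^ s.count a ∣ P)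
    (hdeg : P.natDegree ≤ s.card) : ∃ c, P = C c * (s.map fun a => X - C a).prod := by
  rcases eq_or_ne P 0 with rfl | hP
  · exact ⟨0, by simp⟩
  have hle : s ≤ P.roots := by
    rw [Multiset.le_iff_count]
    intro a
    by_cases ha : a ∈ s
    · rw [count_roots, le_rootMultiplicity_iff hP]
      exact hdvd a ha
    · simp [Multiset.count_eq_zero_of_notMem ha]
  obtain ⟨R, hR⟩ := (Multiset.prod_X_sub_C_dvd_iff_le_roots hP s).mpr hle
  have hm : (s.map fun a => X - C a).prod.Monic := monic_multiset_prod_of_monic _ _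
    fun a _ => monic_X_sub_C a
  have hR0 : R ≠ 0 := by rintro rfl; exact hP (by rw [hR, mul_zero])
  have hd : R.natDegree = 0 := by
    have := congrArg natDegree hR
    rw [hm.natDegree_mul' hR0, natDegree_multiset_prod_X_sub_C_eq_card] at this
    omega
  refine ⟨R.coeff 0, ?_⟩
  rw [← eq_C_of_natDegree_eq_zero hd, mul_comm]
  exact hR

end

/-! ### Expansion along the first two rows -/

/-- The embedding of `0, …, 2n - 1` onto the positions outside the first pair. -/
def shiftPos {n : ℕ} (k : Fin (2 * n)) : Fin (2 * (n + 1)) := ⟨k + 2, by omega⟩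

theorem shiftPos_fstPos {n : ℕ} (i : Fin n) : shiftPos (fstPos i) = fstPos i.succ := by
  ext; simp [shiftPos, fstPos]; ring

theorem shiftPos_sndPos {n : ℕ} (i : Fin n) : shiftPos (sndPos i) = sndPos i.succ := by
  ext; simp [shiftPos, sndPos]; ring

theorem shiftPos_lt {n : ℕ} {i j : Fin (2 * n)} : shiftPos i < shiftPos j ↔ i < j := by
  simp only [shiftPos, Fin.lt_def]; omega

theorem fstPos_zero_lt_sndPos_zero {n : ℕ} : (fstPos 0 : Fin (2 * (n + 1))) < sndPos 0 := by
  simp [fstPos, sndPos]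

theorem fstPos_zero_lt_shiftPos {n : ℕ} (k : Fin (2 * n)) :
    (fstPos 0 : Fin (2 * (n + 1))) < shiftPos k := by
  simp [fstPos, shiftPos, Fin.lt_def]

theorem sndPos_zero_lt_shiftPos {n : ℕ} (k : Fin (2 * n)) :
    (sndPos 0 : Fin (2 * (n + 1))) < shiftPos k := by
  simp only [sndPos, shiftPos, Fin.lt_def, Fin.val_zero]; omega

theorem eq_fstPos_or_eq_sndPos_or_exists_shiftPos {n : ℕ} (i : Fin (2 * (n + 1))) :
    i = fstPos 0 ∨ i = sndPos 0 ∨ ∃ k, i = shiftPos k := by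
  rcases i with ⟨_ | _ | k, hk⟩
  · left; rfl
  · right; left; rfl
  · exact Or.inr (Or.inr ⟨⟨k, by omega⟩, rfl⟩)

theorem prod_shiftPos {M : Type*} [CommMonoid M] {n : ℕ} (f : Fin (2 * (n + 1)) → M) :
    ∏ i, f i = f (fstPos 0) * (f (sndPos 0) * ∏ k, f (shiftPos k)) := by
  change ∏ i : Fin (2 * n + 1 + 1), f i = _
  rw [Fin.prod_univ_succ, Fin.prod_univ_succ]
  rfl

/-- A permutation of the positions outside the first pair, extended by fixing the first pair. -/
def extendPerm {n : ℕ} (σ : Perm (Fin (2 * n))) : Perm (Fin (2 * (n + 1))) :=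
  (Perm.decomposeFin.symm (0, Perm.decomposeFin.symm (0, σ)) : Perm (Fin (2 * n + 1 + 1)))

theorem sign_extendPerm {n : ℕ} (σ : Perm (Fin (2 * n))) :
    Perm.sign (extendPerm σ) = Perm.sign σ := by
  change Perm.sign (Perm.decomposeFin.symm _ : Perm (Fin (2 * n + 1 + 1))) = _
  rw [Perm.decomposeFin.symm_sign, Perm.decomposeFin.symm_sign]
  simp

theorem extendPerm_fstPos_zero {n : ℕ} (σ : Perm (Fin (2 * n))) :
    extendPerm σ (fstPos 0) = fstPos 0 :=
  Perm.decomposeFin_symm_apply_zero (n := 2 * n + 1) 0 _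

theorem extendPerm_sndPos_zero {n : ℕ} (σ : Perm (Fin (2 * n))) :
    extendPerm σ (sndPos 0) = sndPos 0 := by
  have h := Perm.decomposeFin_symm_apply_succ (n := 2 * n + 1)
    (Perm.decomposeFin.symm (0, σ)) 0 0
  rw [Perm.decomposeFin_symm_apply_zero, swap_self] at h
  exact h

theorem extendPerm_shiftPos {n : ℕ} (σ : Perm (Fin (2 * n))) (k : Fin (2 * n)) :
    extendPerm σ (shiftPos k) = shiftPos (σ k) := by
  have h := Perm.decomposeFin_symm_apply_succ (n := 2 * n + 1)
    (Perm.decomposeFin.symm (0, σ)) 0 k.succ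
  rw [Perm.decomposeFin_symm_apply_succ, swap_self] at h
  exact h

theorem exists_extendPerm_eq {n : ℕ} {π : Perm (Fin (2 * (n + 1)))}
    (h0 : π (fstPos 0) = fstPos 0) (h1 : π (sndPos 0) = sndPos 0) : ∃ σ, extendPerm σ = π := by
  let ρ : Perm (Fin (2 * n + 1 + 1)) := π
  have hρ0 : ρ 0 = 0 := h0
  have hρ1 : ρ (Fin.succ 0) = Fin.succ 0 := h1
  obtain ⟨⟨p, τ⟩, hτ⟩ := Perm.decomposeFin.symm.surjective ρ
  have hp : p = 0 := by
    rw [← Perm.decomposeFin_symm_apply_zero p τ, hτ, hρ0]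
  subst hp
  have hτ0 : τ 0 = 0 := by
    have := Perm.decomposeFin_symm_apply_succ τ 0 0
    rw [hτ, hρ1, swap_self] at this
    exact (Fin.succ_injective _ this).symm
  obtain ⟨⟨p', σ⟩, hσ⟩ := Perm.decomposeFin.symm.surjective τ
  have hp' : p' = 0 := by
    rw [← Perm.decomposeFin_symm_apply_zero p' σ, hσ, hτ0]
  subst hp'
  refine ⟨σ, ?_⟩
  change (Perm.decomposeFin.symm (0, Perm.decomposeFin.symm (0, σ)) :
    Perm (Fin (2 * n + 1 + 1))) = ρ
  rw [hσ, hτ]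

theorem extendPerm_mem_matchingPerms {n : ℕ} {σ : Perm (Fin (2 * n))} :
    extendPerm σ ∈ matchingPerms (n + 1) ↔ σ ∈ matchingPerms n := by
  rw [mem_matchingPerms, mem_matchingPerms]
  simp only [Fin.forall_fin_succ, ← shiftPos_fstPos, ← shiftPos_sndPos, extendPerm_shiftPos,
    shiftPos_lt, extendPerm_fstPos_zero, extendPerm_sndPos_zero, Fin.succ_lt_succ_iff]
  simp [fstPos_zero_lt_sndPos_zero, fstPos_zero_lt_shiftPos]

theorem matchingPerms_apply_fstPos_zero {n : ℕ} {π : Perm (Fin (2 * (n + 1)))}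
    (hπ : π ∈ matchingPerms (n + 1)) : π (fstPos 0) = fstPos 0 := by
  rw [mem_matchingPerms] at hπ
  obtain ⟨y, hy⟩ := π.surjective (fstPos 0)
  obtain ⟨⟨i, b⟩, rfl⟩ := (posEquiv (n + 1)).surjective y
  have hmin : ∀ z, ¬ z < (fstPos 0 : Fin (2 * (n + 1))) := fun z => by
    simp [fstPos]
  cases b
  · rcases eq_or_ne i 0 with rfl | hi
    · exact hy
    · have := hπ.2 0 i (Fin.pos_of_ne_zero hi)
      rw [← posEquiv_false i, hy] at this
      exact absurd this (hmin _)
  · have := hπ.1 i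
    rw [← posEquiv_true i, hy] at this
    exact absurd this (hmin _)

theorem pfaffian_of_first_row {K : Type*} [CommRing K] {n : ℕ}
    (B : Matrix (Fin (2 * (n + 1))) (Fin (2 * (n + 1))) K)
    (h : ∀ j, j ≠ sndPos 0 → B (fstPos 0) j = 0) :
    pfaffian B = B (fstPos 0) (sndPos 0) * pfaffian (B.submatrix shiftPos shiftPos) := by
  unfold pfaffian
  rw [Finset.mul_sum]
  symm
  refine Finset.sum_of_injOn extendPerm ?_ ?_ ?_ ?_
  · intro σ _ τ _ hστ
    ext1 k
    have := Perm.ext_iff.mp hστ (shiftPos k)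
    rw [extendPerm_shiftPos, extendPerm_shiftPos] at this
    simpa [shiftPos, Fin.ext_iff] using this
  · intro σ hσ
    exact extendPerm_mem_matchingPerms.mpr hσ
  · intro π hπ hnot
    have h0 := matchingPerms_apply_fstPos_zero hπ
    have h1 : π (sndPos 0) ≠ sndPos 0 := by
      intro h1
      obtain ⟨σ, rfl⟩ := exists_extendPerm_eq h0 h1
      exact hnot ⟨σ, extendPerm_mem_matchingPerms.mp hπ, rfl⟩
    rw [Finset.prod_eq_zero (Finset.mem_univ 0), mul_zero]
    rw [h0, h _ h1]
  · intro σ _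
    rw [Fin.prod_univ_succ, sign_extendPerm]
    simp only [← shiftPos_fstPos, ← shiftPos_sndPos, extendPerm_shiftPos, extendPerm_fstPos_zero,
      extendPerm_sndPos_zero, Matrix.submatrix_apply]
    ring

/-- One step of symplectic elimination: the Pfaffian is the leading entry times the Pfaffian of the
Schur complement of the leading `2 × 2` block. -/
theorem pfaffian_schur_complement {K : Type*} [Field K] {n : ℕ}
    {A : Matrix (Fin (2 * (n + 1))) (Fin (2 * (n + 1))) K}
    (hA : ∀ i j, A j i = -A i j) (h0 : ∀ i, A i i = 0) (ha : A (fstPos 0) (sndPos 0) ≠ 0) :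
    pfaffian A = A (fstPos 0) (sndPos 0) * pfaffian (Matrix.of fun i j : Fin (2 * n) =>
      A (shiftPos i) (shiftPos j) +
        (A (sndPos 0) (shiftPos i) * A (fstPos 0) (shiftPos j) -
          A (fstPos 0) (shiftPos i) * A (sndPos 0) (shiftPos j)) / A (fstPos 0) (sndPos 0)) := by
  set a := A (fstPos 0) (sndPos 0) with ha'
  -- The coefficients with which the first two rows are added to each later row to clear it.
  let α : Fin (2 * (n + 1)) → K := fun i =>
    if i = fstPos 0 ∨ i = sndPos 0 then 0 else A (sndPos 0) i / a
  let β : Fin (2 * (n + 1)) → K := fun i =>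
    if i = fstPos 0 ∨ i = sndPos 0 then 0 else -A (fstPos 0) i / a
  let P : Matrix (Fin (2 * (n + 1))) (Fin (2 * (n + 1))) K := Matrix.of fun i k =>
    (if k = i then 1 else 0) + (if k = fstPos 0 then α i else 0) +
      (if k = sndPos 0 then β i else 0)
  have hPA : ∀ (N : Matrix (Fin (2 * (n + 1))) (Fin (2 * (n + 1))) K) i j,
      (P * N) i j = N i j + α i * N (fstPos 0) j + β i * N (sndPos 0) j := by
    intro N i j
    simp [P, Matrix.mul_apply, add_mul, Finset.sum_add_distrib]
  have hNP : ∀ (N : Matrix (Fin (2 * (n + 1))) (Fin (2 * (n + 1))) K) i j,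
      (N * P.transpose) i j = N i j + α j * N i (fstPos 0) + β j * N i (sndPos 0) := by
    intro N i j
    simp [P, Matrix.mul_apply, mul_add, Finset.sum_add_distrib, mul_comm]
  have hdet : P.det = 1 := by
    have hdiag : ∀ i, P i i = 1 := by
      intro i
      by_cases h : i = fstPos 0 ∨ i = sndPos 0
      · simp [P, α, β, h]
      · rw [not_or] at h
        simp [P, h.1, h.2]
    rw [Matrix.det_of_isLowerTriangular P, Finset.prod_eq_one fun i _ => hdiag i]
    intro i j hij
    have hij' : i < j := hij
    rcases eq_fstPos_or_eq_sndPos_or_exists_shiftPos i with rfl | rfl | ⟨k, rfl⟩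
    · simp [P, α, β, hij'.ne']
    · simp [P, α, β, hij'.ne']
    · have h1 : j ≠ fstPos 0 := by
        rintro rfl; exact hij'.not_gt (fstPos_zero_lt_shiftPos k)
      have h2 : j ≠ sndPos 0 := by
        rintro rfl; exact hij'.not_gt (sndPos_zero_lt_shiftPos k)
      simp [P, h1, h2, hij'.ne']
  have hα0 : α (fstPos 0) = 0 := by simp [α]
  have hα1 : α (sndPos 0) = 0 := by simp [α]
  have hβ0 : β (fstPos 0) = 0 := by simp [β]
  have hβ1 : β (sndPos 0) = 0 := by simp [β]
  have hne : ∀ k : Fin (2 * n), ¬ (shiftPos k = fstPos 0 ∨ shiftPos k = sndPos 0) := by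
    intro k; simp [shiftPos, fstPos, sndPos]
  have hα : ∀ k : Fin (2 * n), α (shiftPos k) = A (sndPos 0) (shiftPos k) / a := fun k =>
    if_neg (hne k)
  have hβ : ∀ k : Fin (2 * n), β (shiftPos k) = -A (fstPos 0) (shiftPos k) / a := fun k =>
    if_neg (hne k)
  have h := pfaffian_congruence P hA h0
  rw [hdet, one_mul] at h
  rw [← h, pfaffian_of_first_row]
  · congr 1
    · rw [hNP, hPA, hα0, hβ0, hα1, hβ1]; ring
    · congr 1
      ext i j
      rw [Matrix.submatrix_apply, Matrix.of_apply, hNP, hPA, hPA, hPA, hα, hβ, hα, hβ, h0, h0,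
        hA (fstPos 0) (sndPos 0), hA (fstPos 0) (shiftPos i), hA (sndPos 0) (shiftPos i), ← ha']
      field_simp
      ring
  · intro j hj
    rw [hNP, hPA, hPA, hPA, hα0, hβ0, h0]
    rcases eq_fstPos_or_eq_sndPos_or_exists_shiftPos j with rfl | rfl | ⟨k, rfl⟩
    · rw [hα0, hβ0, h0]; ring
    · exact absurd rfl hj
    · rw [hα, hβ, ← ha']
      field_simp
      ring

/-! ### Schur's Pfaffian -/

theorem prod_lt_shiftPos {M : Type*} [CommMonoid M] {n : ℕ}
    (f : Fin (2 * (n + 1)) → Fin (2 * (n + 1)) → M) :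
    ∏ i, ∏ j, (if i < j then f i j else 1) = f (fstPos 0) (sndPos 0) *
      (∏ k, f (fstPos 0) (shiftPos k) * f (sndPos 0) (shiftPos k)) *
        ∏ i : Fin (2 * n), ∏ j : Fin (2 * n), if i < j then f (shiftPos i) (shiftPos j) else 1 := by
  have a := fstPos_zero_lt_sndPos_zero (n := n)
  have b := fstPos_zero_lt_shiftPos (n := n)
  have c := sndPos_zero_lt_shiftPos (n := n)
  simp only [prod_shiftPos, shiftPos_lt, a, b, c, (b _).not_gt, (c _).not_gt, a.not_gt, lt_irrefl,
    if_true, if_false, one_mul, Finset.prod_const_one, Finset.prod_mul_distrib]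
  simp only [mul_assoc, one_mul]

/-- The case of four variables of Schur's Pfaffian, solved for the last factor. -/
theorem schur_four_point {K : Type*} [Field K] {u v y z : K} (huv : u ≠ v) (h1 : u * v ≠ 1)
    (h2 : u * y ≠ 1) (h3 : u * z ≠ 1) (h4 : v * y ≠ 1) (h5 : v * z ≠ 1) (h6 : y * z ≠ 1) :
    (z - y) / (y * z - 1) + ((y - v) / (v * y - 1) * ((z - u) / (u * z - 1)) -
        (y - u) / (u * y - 1) * ((z - v) / (v * z - 1))) / ((v - u) / (u * v - 1)) =
      (y - u) / (u * y - 1) * ((y - v) / (v * y - 1)) *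
        ((z - u) / (u * z - 1) * ((z - v) / (v * z - 1))) * ((z - y) / (y * z - 1)) := by
  have e0 := sub_ne_zero.mpr huv.symm
  have e1 := sub_ne_zero.mpr h1
  have e2 := sub_ne_zero.mpr h2
  have e3 := sub_ne_zero.mpr h3
  have e4 := sub_ne_zero.mpr h4
  have e5 := sub_ne_zero.mpr h5
  have e6 := sub_ne_zero.mpr h6
  generalize hd0 : v - u = d0 at *
  generalize hd1 : u * v - 1 = d1 at *
  generalize hd2 : u * y - 1 = d2 at *
  generalize hd3 : u * z - 1 = d3 at *
  generalize hd4 : v * y - 1 = d4 at *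
  generalize hd5 : v * z - 1 = d5 at *
  generalize hd6 : y * z - 1 = d6 at *
  field_simp
  subst hd0 hd1 hd2 hd3 hd4 hd5 hd6
  ring

/-- Schur's Pfaffian, in the form `Pf ((xⱼ - xᵢ) / (xᵢ xⱼ - 1)) = ∏ (xⱼ - xᵢ) / (xᵢ xⱼ - 1)`. The
Schur complement of the leading block is a rescaling of the matrix of the remaining variables. -/
theorem pfaffian_schur {K : Type*} [Field K] {n : ℕ} (x : Fin (2 * n) → K)
    (hx : ∀ i j, i ≠ j → x i ≠ x j) (hx' : ∀ i j, i ≠ j → x i * x j ≠ 1) :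
    pfaffian (Matrix.of fun i j => (x j - x i) / (x i * x j - 1)) =
      ∏ i, ∏ j, if i < j then (x j - x i) / (x i * x j - 1) else 1 := by
  induction n with
  | zero => simp [pfaffian, matchingPerms]
  | succ n ih =>
    set a : Fin (2 * (n + 1)) → Fin (2 * (n + 1)) → K :=
      fun i j => (x j - x i) / (x i * x j - 1) with ha
    have h01 : (fstPos 0 : Fin (2 * (n + 1))) ≠ sndPos 0 := fstPos_zero_lt_sndPos_zero.ne
    have h0 : ∀ k : Fin (2 * n), (fstPos 0 : Fin (2 * (n + 1))) ≠ shiftPos k := fun k =>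
      (fstPos_zero_lt_shiftPos k).ne
    have h1 : ∀ k : Fin (2 * n), (sndPos 0 : Fin (2 * (n + 1))) ≠ shiftPos k := fun k =>
      (sndPos_zero_lt_shiftPos k).ne
    have hne : ∀ i j : Fin (2 * n), i ≠ j →
        (shiftPos i : Fin (2 * (n + 1))) ≠ shiftPos j := fun i j hij => by
      simpa [shiftPos, Fin.ext_iff] using hij
    rw [pfaffian_schur_complement]
    · rw [prod_lt_shiftPos]
      have key : (Matrix.of fun i j : Fin (2 * n) => a (shiftPos i) (shiftPos j) +
          (a (sndPos 0) (shiftPos i) * a (fstPos 0) (shiftPos j) -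
            a (fstPos 0) (shiftPos i) * a (sndPos 0) (shiftPos j)) / a (fstPos 0) (sndPos 0)) =
          Matrix.of fun i j => (a (fstPos 0) (shiftPos i) * a (sndPos 0) (shiftPos i)) *
            (a (fstPos 0) (shiftPos j) * a (sndPos 0) (shiftPos j)) *
              (Matrix.of fun i j => (x (shiftPos j) - x (shiftPos i)) /
                (x (shiftPos i) * x (shiftPos j) - 1)) i j := by
        ext i j
        simp only [Matrix.of_apply, ha]
        rcases eq_or_ne i j with rfl | hij
        · ring
        exact schur_four_point (hx _ _ h01) (hx' _ _ h01) (hx' _ _ (h0 i)) (hx' _ _ (h0 j))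
          (hx' _ _ (h1 i)) (hx' _ _ (h1 j)) (hx' _ _ (hne i j hij))
      have := ih (fun k => x (shiftPos k)) (fun i j hij => hx _ _ (hne i j hij))
        (fun i j hij => hx' _ _ (hne i j hij))
      change a _ _ * pfaffian (Matrix.of fun i j : Fin (2 * n) => a (shiftPos i) (shiftPos j) +
          (a (sndPos 0) (shiftPos i) * a (fstPos 0) (shiftPos j) -
            a (fstPos 0) (shiftPos i) * a (sndPos 0) (shiftPos j)) / a (fstPos 0) (sndPos 0)) = _
      rw [key, pfaffian_diagonal_scaling, this]
      simp only [ha]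
      ring
    · intro i j
      simp only [Matrix.of_apply, ha]
      rw [mul_comm (x j), ← neg_sub (x j), neg_div]
    · intro i; simp [ha]
    · exact div_ne_zero (sub_ne_zero.mpr (hx _ _ h01.symm)) (sub_ne_zero.mpr (hx' _ _ h01))

/-! ### The Pfaffian of the antidiagonal matrix -/

/-- The antisymmetric matrix with entries `1` above and `-1` below the middle of the
antidiagonal. -/
def antidiag (K : Type*) [CommRing K] (n : ℕ) : Matrix (Fin (2 * n)) (Fin (2 * n)) K :=
  Matrix.of fun a b => if (a : ℕ) + b + 1 = 2 * n then (if a < b then 1 else -1) else 0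

/-- The permutation that lists the nested matching `{{0, 2n - 1}, {1, 2n - 2}, …}`. -/
def nestedPerm (n : ℕ) : Perm (Fin (2 * n)) where
  toFun k := if (k : ℕ) % 2 = 0 then ⟨k / 2, by omega⟩ else ⟨2 * n - 1 - k / 2, by omega⟩
  invFun m := if h : (m : ℕ) < n then ⟨2 * m, by omega⟩ else ⟨2 * (2 * n - 1 - m) + 1, by omega⟩
  left_inv k := by
    ext
    rcases Nat.mod_two_eq_zero_or_one k with h | h
    · have : (k : ℕ) / 2 < n := by omega
      simp only [h, if_true, this, dite_true]; omega
    · have : ¬ (2 * n - 1 - (k : ℕ) / 2 < n) := by omega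
      simp only [h, one_ne_zero, if_false, this, dite_false]; omega
  right_inv m := by
    ext
    by_cases h : (m : ℕ) < n
    · have : 2 * (m : ℕ) % 2 = 0 := by omega
      simp only [h, dite_true, this, if_true]; omega
    · have : ¬ ((2 * (2 * n - 1 - (m : ℕ)) + 1) % 2 = 0) := by omega
      simp only [h, dite_false, this, if_false]; omega

theorem nestedPerm_even {n : ℕ} {k : Fin (2 * n)} (h : (k : ℕ) % 2 = 0) :
    (nestedPerm n k : ℕ) = k / 2 := by
  simp [nestedPerm, h]

theorem nestedPerm_odd {n : ℕ} {k : Fin (2 * n)} (h : (k : ℕ) % 2 = 1) :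
    (nestedPerm n k : ℕ) = 2 * n - 1 - k / 2 := by
  simp [nestedPerm, h]

theorem nestedPerm_fstPos {n : ℕ} (i : Fin n) : (nestedPerm n (fstPos i) : ℕ) = i := by
  rw [nestedPerm_even (by simp [fstPos])]; simp [fstPos]

theorem nestedPerm_sndPos {n : ℕ} (i : Fin n) :
    (nestedPerm n (sndPos i) : ℕ) = 2 * n - 1 - i := by
  rw [nestedPerm_odd (by simp [sndPos, Nat.add_mod])]; simp [sndPos]; omega

/-- The value at an odd position `i` is smaller than none of the later ones, whose number is even,
and the value at an even position is smaller than all later ones. -/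
theorem sign_nestedPerm (n : ℕ) : Perm.sign (nestedPerm n) = 1 := by
  rw [Perm.sign_eq_prod_prod_Ioi]
  refine Finset.prod_eq_one fun i _ => ?_
  rcases Nat.mod_two_eq_zero_or_one i with h | h
  · refine Finset.prod_eq_one fun j hj => if_pos ?_
    have hij := Fin.lt_def.mp (Finset.mem_Ioi.mp hj)
    rw [Fin.lt_def, nestedPerm_even h]
    rcases Nat.mod_two_eq_zero_or_one j with h' | h'
    · rw [nestedPerm_even h']; omega
    · rw [nestedPerm_odd h']; omega
  · have hall : ∀ j ∈ Ioi i, (if nestedPerm n i < nestedPerm n j then (1 : ℤˣ) else -1) = -1 := by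
      intro j hj
      refine if_neg ?_
      have hij := Fin.lt_def.mp (Finset.mem_Ioi.mp hj)
      rw [Fin.lt_def, nestedPerm_odd h]
      rcases Nat.mod_two_eq_zero_or_one j with h' | h'
      · rw [nestedPerm_even h']; omega
      · rw [nestedPerm_odd h']; omega
    rw [Finset.prod_congr rfl hall, Finset.prod_const, Fin.card_Ioi]
    refine Even.neg_one_pow ?_
    rw [Nat.even_iff]; omega

theorem nestedPerm_mem_matchingPerms (n : ℕ) : nestedPerm n ∈ matchingPerms n := by
  rw [mem_matchingPerms]
  refine ⟨fun i => ?_, fun i j hij => ?_⟩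
  · rw [Fin.lt_def, nestedPerm_fstPos, nestedPerm_sndPos]; omega
  · rw [Fin.lt_def, nestedPerm_fstPos, nestedPerm_fstPos]; exact hij

/-- The nested matching is the involution `y ↦ 2n - 1 - y`. -/
theorem eq_nestedPerm {n : ℕ} {π : Perm (Fin (2 * n))} (hπ : π ∈ matchingPerms n)
    (h : ∀ i, (π (fstPos i) : ℕ) + π (sndPos i) + 1 = 2 * n) : π = nestedPerm n := by
  have key : ∀ ρ : Perm (Fin (2 * n)), (∀ i, (ρ (fstPos i) : ℕ) + ρ (sndPos i) + 1 = 2 * n) →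
      ∀ y, (matching ρ y : ℕ) = 2 * n - 1 - y := by
    intro ρ hρ y
    obtain ⟨x, rfl⟩ := ρ.surjective y
    rw [matching_apply]
    obtain ⟨⟨i, b⟩, rfl⟩ := (posEquiv n).surjective x
    have := hρ i
    cases b
    · simp only [posEquiv_false, partner_fstPos]; omega
    · simp only [posEquiv_true, partner_sndPos]; omega
  refine eq_of_matching_eq hπ (nestedPerm_mem_matchingPerms n) ?_
  ext y
  rw [key π h, key _ fun i => by rw [nestedPerm_fstPos, nestedPerm_sndPos]; omega]

theorem pfaffian_antidiag (K : Type*) [CommRing K] (n : ℕ) : pfaffian (antidiag K n) = 1 := by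
  unfold pfaffian
  rw [Finset.sum_eq_single (nestedPerm n)]
  · rw [sign_nestedPerm, Finset.prod_eq_one]
    · simp
    · intro i _
      simp only [antidiag, Matrix.of_apply, nestedPerm_fstPos, nestedPerm_sndPos, Fin.lt_def]
      rw [if_pos (by omega), if_pos (by omega)]
  · intro π hπ hne
    obtain ⟨i, hi⟩ : ∃ i, ¬ (π (fstPos i) : ℕ) + π (sndPos i) + 1 = 2 * n := by
      by_contra hcon
      push Not at hcon
      exact hne (eq_nestedPerm hπ hcon)
    rw [Finset.prod_eq_zero (Finset.mem_univ i), mul_zero]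
    simp only [antidiag, Matrix.of_apply]
    exact if_neg hi
  · intro h
    exact absurd (nestedPerm_mem_matchingPerms n) h

theorem prod_Ioi_eq_prod_ite {M : Type*} [CommMonoid M] {N : ℕ} (i : Fin N) (f : Fin N → M) :
    ∏ j ∈ Ioi i, f j = ∏ j, if i < j then f j else 1 := by
  rw [← Finset.prod_filter]
  congr 1
  ext j; simp

/-- The matrix is `V J Vᵀ`, with `V` the Vandermonde matrix and `J` the antidiagonal one. -/
theorem pfaffian_sq_div_sub {K : Type*} [Field K] {n : ℕ} {x : Fin (2 * n) → K}
    (hx : Function.Injective x) :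
    pfaffian (Matrix.of fun i j => (x j ^ n - x i ^ n) * (x j ^ n - x i ^ n) / (x j - x i)) =
      ∏ i, ∏ j, if i < j then x j - x i else 1 := by
  have hM : (Matrix.of fun i j => (x j ^ n - x i ^ n) * (x j ^ n - x i ^ n) / (x j - x i)) =
      Matrix.vandermonde x * antidiag K n * (Matrix.vandermonde x).transpose := by
    ext i j
    have e : (Matrix.vandermonde x * antidiag K n * (Matrix.vandermonde x).transpose) i j =
        ∑ a ∈ range (2 * n), x i ^ a * x j ^ (2 * n - 1 - a) * (if a < n then 1 else -1) := by
      rw [Matrix.mul_assoc, Matrix.mul_apply, ← Fin.sum_univ_eq_sum_range (fun a =>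
        x i ^ a * x j ^ (2 * n - 1 - a) * (if a < n then 1 else -1))]
      refine Finset.sum_congr rfl fun a _ => ?_
      rw [Matrix.mul_apply, Finset.sum_eq_single a.rev]
      · have h1 : (a : ℕ) + (a.rev : ℕ) + 1 = 2 * n := by rw [Fin.val_rev]; omega
        have h2 : (a < a.rev) ↔ (a : ℕ) < n := by rw [Fin.lt_def, Fin.val_rev]; omega
        have h3 : (a.rev : ℕ) = 2 * n - 1 - a := by rw [Fin.val_rev]; omega
        simp only [antidiag, Matrix.of_apply, Matrix.transpose_apply, Matrix.vandermonde_apply]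
        rw [if_pos h1]
        simp only [h2]
        rw [h3]
        ring
      · intro b _ hb
        have h1 : ¬ (a : ℕ) + (b : ℕ) + 1 = 2 * n := by
          intro h; apply hb; ext; rw [Fin.val_rev]; omega
        simp only [antidiag, Matrix.of_apply]
        rw [if_neg h1, zero_mul]
      · simp
    have e2 : ∑ a ∈ range (2 * n), x i ^ a * x j ^ (2 * n - 1 - a) * (if a < n then 1 else -1) =
        (x j ^ n - x i ^ n) * ∑ l ∈ range n, x j ^ l * x i ^ (n - 1 - l) := by
      rw [two_mul n, Finset.sum_range_add, sub_mul, Finset.mul_sum, Finset.mul_sum, sub_eq_add_neg,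
        ← Finset.sum_neg_distrib]
      congr 1
      · rw [← Finset.sum_range_reflect]
        refine Finset.sum_congr rfl fun l hl => ?_
        rw [Finset.mem_range] at hl
        rw [if_pos (by omega), show n + n - 1 - (n - 1 - l) = n + l by omega, pow_add]
        ring
      · rw [← Finset.sum_range_reflect]
        refine Finset.sum_congr rfl fun l hl => ?_
        rw [Finset.mem_range] at hl
        rw [if_neg (by omega), show n + n - 1 - (n + (n - 1 - l)) = l by omega, pow_add]
        ring
    rw [e, e2, Matrix.of_apply]
    rcases eq_or_ne i j with rfl | hij
    · simp
    · rw [div_eq_iff (sub_ne_zero.mpr fun h => hij (hx h).symm), mul_assoc, geom_sum₂_mul]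
  have hJ : ∀ a b, antidiag K n b a = -antidiag K n a b := by
    intro a b
    simp only [antidiag, Matrix.of_apply, add_comm (b : ℕ)]
    rcases lt_trichotomy a b with h | rfl | h
    · simp only [h, h.not_gt, if_true, if_false]; split_ifs <;> simp
    · rw [if_neg (by omega)]; simp
    · simp only [h, h.not_gt, if_true, if_false]; split_ifs <;> simp
  have hJ0 : ∀ a, antidiag K n a a = 0 := by
    intro a
    simp only [antidiag, Matrix.of_apply]
    exact if_neg (by omega)
  rw [hM, pfaffian_congruence _ hJ hJ0, pfaffian_antidiag, mul_one, Matrix.det_vandermonde]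
  exact Finset.prod_congr rfl fun i _ => prod_Ioi_eq_prod_ite _ _

/-! ### Polynomials with prescribed zeros at powers of `p` -/

open Polynomial in
/-- If the multiplicities of the zeros `p ^ e x`, each counted as often as the exponent occurs, and
of the zero at the origin add up to the degree bound, the polynomial is known up to a constant. -/
theorem exists_eval_eq_of_pow_dvd {K ι : Type*} [Field K] [Fintype ι] {p : K} (hp : p ≠ 0)
    {e : ι → ℤ} (hinj : ∀ x y, p ^ e x = p ^ e y → e x = e y) {P : K[X]} {d : ℕ}
    (h0 : X ^ d ∣ P)
    (hdvd : ∀ x, (X - C (p ^ e x)) ^ (univ.filter fun y => e y = e x).card ∣ P)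
    (hdeg : P.natDegree ≤ d + Fintype.card ι) :
    ∃ c, ∀ q, eval q P = c * (q ^ d * ∏ x, (q - p ^ e x)) := by
  classical
  let s : Multiset K := Multiset.replicate d 0 + univ.val.map fun x => p ^ e x
  obtain ⟨c, hc⟩ := exists_eq_C_mul_prod (P := P) s (by
    intro a ha
    rw [Multiset.mem_add] at ha
    have hcount : s.count a = (Multiset.replicate d 0).count a +
        (univ.filter fun x => a = p ^ e x).card := by
      rw [Multiset.count_add, Multiset.count_map]; rfl
    rw [hcount]
    by_cases ha0 : a = 0
    · subst ha0
      have h1 : (univ.filter fun x => 0 = p ^ e x) = ∅ :=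
        Finset.filter_eq_empty_iff.mpr fun x _ => (zpow_ne_zero _ hp).symm
      rw [h1, Multiset.count_replicate_self]
      simpa using h0
    · have h1 : (Multiset.replicate d (0 : K)).count a = 0 :=
        Multiset.count_eq_zero_of_notMem fun h => ha0 (Multiset.eq_of_mem_replicate h)
      have h2 : a ∈ univ.val.map fun x => p ^ e x :=
        ha.resolve_left fun h => ha0 (Multiset.eq_of_mem_replicate h)
      obtain ⟨x, -, rfl⟩ := Multiset.mem_map.mp h2
      rw [h1, zero_add]
      refine (pow_dvd_pow _ (Finset.card_le_card ?_)).trans (hdvd x)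
      intro y hy
      rw [mem_filter] at hy ⊢
      exact ⟨hy.1, (hinj x y hy.2).symm⟩)
    (by simpa [s] using hdeg)
  refine ⟨c, fun q => ?_⟩
  rw [hc, eval_mul, eval_C, eval_multiset_prod, Multiset.map_map, Multiset.map_add,
    Multiset.prod_add, Multiset.map_replicate, Multiset.prod_replicate, Multiset.map_map,
    Finset.prod_eq_multiset_prod]
  simp [Function.comp_def]

/-- A symmetric function of two variables that is, in each variable, a multiple of `g`. -/
theorem mul_sq_eq_of_proportional {K : Type*} [Field K] {Φ : K → K → K} {g : K → K}
    (hsymm : ∀ q r, Φ q r = Φ r q) (h : ∀ r, ∃ c, ∀ q, Φ q r = c * g q) (t q r : K) :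
    Φ q r * g t ^ 2 = Φ t t * (g q * g r) := by
  obtain ⟨c, hc⟩ := h r
  obtain ⟨c', hc'⟩ := h t
  have h1 : Φ t r = Φ r t := hsymm t r
  rw [hc, hc'] at h1
  rw [hc, hc']
  linear_combination g q * g t * h1

/-! ### The first Pfaffian as a polynomial in `q` -/

/-- The matrix `T₅` up to rescaling of rows and columns, with entries polynomial in `q` and `r`. The
diagonal entries are `0 / 0 = 0`. -/
def normT₅ {K : Type*} [Field K] (n : ℕ) (p q r : K) : Matrix (Fin (2 * n)) (Fin (2 * n)) K :=
  Matrix.of fun i j => (q ^ (j : ℕ) - q ^ (i : ℕ)) * (r ^ (j : ℕ) - r ^ (i : ℕ)) /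
    (p ^ (j : ℕ) - p ^ (i : ℕ))

theorem le_matchingPerms_fstPos {n : ℕ} {π : Perm (Fin (2 * n))} (hπ : π ∈ matchingPerms n)
    (i : Fin n) : (i : ℕ) ≤ π (fstPos i) := by
  rw [mem_matchingPerms] at hπ
  obtain ⟨k, hk⟩ := i
  induction k with
  | zero => exact Nat.zero_le _
  | succ k ih =>
    have h1 := ih (by omega)
    have h2 : (π (fstPos ⟨k, by omega⟩) : ℕ) < π (fstPos ⟨k + 1, hk⟩) :=
      hπ.2 ⟨k, by omega⟩ ⟨k + 1, hk⟩ (by simp [Fin.lt_def])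
    simp only at h1 ⊢
    omega

theorem sum_fin_two_mul (n : ℕ) :
    ∑ x : Fin (2 * n), (x : ℕ) = 2 * (∑ i : Fin n, (i : ℕ)) + n * n := by
  rw [Fin.sum_univ_eq_sum_range (fun x => x), Fin.sum_univ_eq_sum_range (fun x => x),
    two_mul n, Finset.sum_range_add, Finset.sum_add_distrib]
  simp only [Finset.sum_const, Finset.card_range, smul_eq_mul]
  ring

theorem sum_matchingPerms {n : ℕ} (π : Perm (Fin (2 * n))) :
    ∑ i : Fin n, (π (fstPos i) : ℕ) + ∑ i : Fin n, (π (sndPos i) : ℕ) =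
      2 * (∑ i : Fin n, (i : ℕ)) + n * n := by
  rw [← sum_fin_two_mul, ← Equiv.sum_comp π, ← Finset.sum_add_distrib,
    ← (posEquiv n).sum_comp, Fintype.sum_prod_type]
  simp [add_comm]

open Polynomial in
/-- The `i`-th pair contributes at least the power `i`, as the first members increase with `i`. -/
theorem X_pow_dvd_pfaffian {K : Type*} [Field K] {n : ℕ} (c : Fin (2 * n) → Fin (2 * n) → K) :
    X ^ (∑ i : Fin n, (i : ℕ)) ∣
      pfaffian (Matrix.of fun i j => (X ^ (j : ℕ) - X ^ (i : ℕ)) * C (c i j)) := by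
  refine Finset.dvd_sum fun π hπ => Dvd.dvd.mul_left ?_ _
  rw [← Finset.prod_pow_eq_pow_sum]
  refine Finset.prod_dvd_prod_of_dvd _ _ fun i _ => Dvd.dvd.mul_right ?_ _
  have h1 := le_matchingPerms_fstPos hπ i
  have h2 : (π (fstPos i) : ℕ) < π (sndPos i) := (mem_matchingPerms.mp hπ).1 i
  exact dvd_sub (pow_dvd_pow _ (by omega)) (pow_dvd_pow _ h1)

open Polynomial in
/-- The degree of a summand is at most the sum of the second members, and the first members sum to
at least `∑ i`. -/
theorem natDegree_pfaffian_le {K : Type*} [Field K] {n : ℕ} (c : Fin (2 * n) → Fin (2 * n) → K) :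
    (pfaffian (Matrix.of fun i j => (X ^ (j : ℕ) - X ^ (i : ℕ)) * C (c i j))).natDegree ≤
      ∑ i : Fin n, (i : ℕ) + n * n := by
  refine natDegree_sum_le_of_forall_le _ _ fun π hπ => ?_
  rw [← C_eq_intCast]
  refine (natDegree_C_mul_le _ _).trans ?_
  refine (natDegree_prod_le _ _).trans ?_
  have h1 : ∑ i : Fin n, (i : ℕ) ≤ ∑ i : Fin n, (π (fstPos i) : ℕ) :=
    Finset.sum_le_sum fun i _ => le_matchingPerms_fstPos hπ i
  have h2 := sum_matchingPerms π
  refine le_trans (Finset.sum_le_sum (g := fun i => (π (sndPos i) : ℕ)) fun i _ => ?_) (by omega)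
  have h3 : (π (fstPos i) : ℕ) < π (sndPos i) := (mem_matchingPerms.mp hπ).1 i
  have h4 := natDegree_sub_le (X ^ (π (sndPos i) : ℕ) : K[X]) (X ^ (π (fstPos i) : ℕ))
  rw [natDegree_X_pow, natDegree_X_pow, max_eq_left h3.le] at h4
  exact (natDegree_mul_C_le _ _).trans h4

theorem zpow_inj_of_pow_ne_one {K : Type*} [Field K] {p : K} (hp : p ≠ 0) {N : ℕ}
    (h : ∀ k, 1 ≤ k → k < N → p ^ k ≠ 1) {a b : ℤ} (hab : p ^ a = p ^ b) (hN : |a - b| < N) :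
    a = b := by
  by_contra hne
  rw [abs_lt] at hN
  have h1 : p ^ (a - b) = 1 := by rw [zpow_sub₀ hp, hab, div_self (zpow_ne_zero _ hp)]
  have h2 : p ^ |a - b| = 1 := by
    rcases abs_choice (a - b) with h' | h' <;> rw [h']
    · exact h1
    · rw [zpow_neg, h1, inv_one]
  refine h (a - b).natAbs (by omega) (by omega) ?_
  rw [← zpow_natCast, Int.natCast_natAbs, h2]

/-- At `q = p ^ k`, the matrix is `∑ₗ xⱼˡ xᵢᵏ⁻¹⁻ˡ (rʲ - rⁱ)` with `xᵢ = pⁱ`, and thus of rank at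
most `2 * k`; the case of negative exponents is reduced to this one by rescaling. -/
theorem rank_normT₅_le {K : Type*} [Field K] {n : ℕ} {p : K} (hp : p ≠ 0) (r : K)
    (hx : ∀ i j : Fin (2 * n), p ^ (i : ℕ) = p ^ (j : ℕ) → i = j) (m : ℤ) :
    (normT₅ n p (p ^ m) r).rank ≤ 2 * m.natAbs := by
  have key : ∀ (k : ℕ) (i j : Fin (2 * n)), ((p ^ k) ^ (j : ℕ) - (p ^ k) ^ (i : ℕ)) *
      (r ^ (j : ℕ) - r ^ (i : ℕ)) / (p ^ (j : ℕ) - p ^ (i : ℕ)) =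
      ∑ l : Fin k, ((p ^ (i : ℕ)) ^ (k - 1 - l) * ((p ^ (j : ℕ)) ^ (l : ℕ) * r ^ (j : ℕ)) -
        ((p ^ (i : ℕ)) ^ (l : ℕ) * r ^ (i : ℕ)) * (p ^ (j : ℕ)) ^ (k - 1 - l)) := by
    intro k i j
    rw [Finset.sum_sub_distrib,
      Fin.sum_univ_eq_sum_range (fun l => (p ^ (i : ℕ)) ^ (k - 1 - l) *
        ((p ^ (j : ℕ)) ^ l * r ^ (j : ℕ))) k,
      Fin.sum_univ_eq_sum_range (fun l => ((p ^ (i : ℕ)) ^ l * r ^ (i : ℕ)) *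
        (p ^ (j : ℕ)) ^ (k - 1 - l)) k, ← Finset.sum_range_reflect (fun l =>
        ((p ^ (i : ℕ)) ^ l * r ^ (i : ℕ)) * (p ^ (j : ℕ)) ^ (k - 1 - l))]
    have e1 : ∑ l ∈ range k, (p ^ (i : ℕ)) ^ (k - 1 - l) * ((p ^ (j : ℕ)) ^ l * r ^ (j : ℕ)) =
        (∑ l ∈ range k, (p ^ (j : ℕ)) ^ l * (p ^ (i : ℕ)) ^ (k - 1 - l)) * r ^ (j : ℕ) := by
      rw [Finset.sum_mul]
      exact Finset.sum_congr rfl fun l _ => by ring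
    have e2 : ∑ l ∈ range k, ((p ^ (i : ℕ)) ^ (k - 1 - l) * r ^ (i : ℕ)) *
        (p ^ (j : ℕ)) ^ (k - 1 - (k - 1 - l)) =
        (∑ l ∈ range k, (p ^ (j : ℕ)) ^ l * (p ^ (i : ℕ)) ^ (k - 1 - l)) * r ^ (i : ℕ) := by
      rw [Finset.sum_mul]
      refine Finset.sum_congr rfl fun l hl => ?_
      rw [Finset.mem_range] at hl
      rw [show k - 1 - (k - 1 - l) = l by omega]; ring
    rw [e1, e2]
    rcases eq_or_ne i j with rfl | hij
    · simp
    · rw [div_eq_iff (sub_ne_zero.mpr fun h => hij (hx _ _ h).symm), pow_right_comm p k,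
        pow_right_comm p k, ← geom_sum₂_mul]
      ring
  obtain ⟨k, rfl | rfl⟩ := m.eq_nat_or_neg
  · rw [Int.natAbs_natCast]
    refine rank_le_two_mul (k := k) (fun l i => (p ^ (i : ℕ)) ^ (k - 1 - l))
      (fun l j => (p ^ (j : ℕ)) ^ (l : ℕ) * r ^ (j : ℕ)) fun i j => ?_
    rw [normT₅, Matrix.of_apply, zpow_natCast, key]
  · rw [Int.natAbs_neg, Int.natAbs_natCast]
    refine rank_le_two_mul (k := k)
      (fun l i => ((p ^ k) ^ (i : ℕ))⁻¹ * ((p ^ (i : ℕ)) ^ (l : ℕ) * r ^ (i : ℕ)))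
      (fun l j => ((p ^ k) ^ (j : ℕ))⁻¹ * (p ^ (j : ℕ)) ^ (k - 1 - l)) fun i j => ?_
    have e3 : normT₅ n p (p ^ (-(k : ℤ))) r i j = -(((p ^ k) ^ (i : ℕ))⁻¹ * ((p ^ k) ^ (j : ℕ))⁻¹ *
        (((p ^ k) ^ (j : ℕ) - (p ^ k) ^ (i : ℕ)) *
          (r ^ (j : ℕ) - r ^ (i : ℕ)) / (p ^ (j : ℕ) - p ^ (i : ℕ)))) := by
      have h1 : (p ^ k) ^ (i : ℕ) ≠ 0 := pow_ne_zero _ (pow_ne_zero _ hp)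
      have h2 : (p ^ k) ^ (j : ℕ) ≠ 0 := pow_ne_zero _ (pow_ne_zero _ hp)
      rw [normT₅, Matrix.of_apply, zpow_neg, zpow_natCast, inv_pow, inv_pow]
      generalize (p ^ k) ^ (i : ℕ) = a at *
      generalize (p ^ k) ^ (j : ℕ) = b at *
      generalize p ^ (j : ℕ) - p ^ (i : ℕ) = d
      have : b⁻¹ - a⁻¹ = -(a⁻¹ * b⁻¹ * (b - a)) := by field_simp; ring
      rw [this]; ring
    rw [e3, key, Finset.mul_sum, ← Finset.sum_neg_distrib]
    refine Finset.sum_congr rfl fun l _ => ?_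
    ring

theorem normT₅_swap {K : Type*} [Field K] (n : ℕ) (p q r : K) :
    normT₅ n p q r = normT₅ n p r q := by
  ext i j
  rw [normT₅, normT₅, Matrix.of_apply, Matrix.of_apply, mul_comm (q ^ _ - _)]

theorem card_filter_sub_le {n : ℕ} (m : ℤ) :
    (univ.filter fun y : Fin n × Fin n => (y.1 : ℤ) - y.2 = m).card ≤ n - m.natAbs := by
  rw [← Finset.card_range (n - m.natAbs)]
  refine Finset.card_le_card_of_injOn (fun y => min (y.1 : ℕ) y.2) ?_ ?_
  · intro y hy
    have : (y.1 : ℤ) - y.2 = m := by simpa using hy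
    simp only [coe_range, Set.mem_Iio]
    omega
  · rintro ⟨a, b⟩ hx ⟨a', b'⟩ hy hxy
    have h1 : (a : ℤ) - b = m := by simpa using hx
    have h2 : (a' : ℤ) - b' = m := by simpa using hy
    simp only at hxy
    ext <;> simp only <;> omega

open Polynomial in
/-- The zeros at the origin and at the powers of `p` exhaust the degree. -/
theorem exists_pfaffian_normT₅_eq {K : Type*} [Field K] {n : ℕ} {p : K} (hp : p ≠ 0)
    (h : ∀ k, 1 ≤ k → k < 2 * n → p ^ k ≠ 1) (r : K) :
    ∃ c, ∀ q, pfaffian (normT₅ n p q r) = c * (q ^ (∑ i : Fin n, (i : ℕ)) *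
      ∏ y : Fin n × Fin n, (q - p ^ ((y.1 : ℤ) - y.2))) := by
  let c : Fin (2 * n) → Fin (2 * n) → K := fun i j =>
    (r ^ (j : ℕ) - r ^ (i : ℕ)) / (p ^ (j : ℕ) - p ^ (i : ℕ))
  have hc : ∀ i j, c j i = c i j := fun i j => by
    simp only [c]
    rw [← neg_sub (r ^ (j : ℕ)), ← neg_sub (p ^ (j : ℕ)), neg_div_neg_eq]
  set A : Matrix (Fin (2 * n)) (Fin (2 * n)) K[X] :=
    Matrix.of fun i j => (X ^ (j : ℕ) - X ^ (i : ℕ)) * C (c i j) with hAdef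
  have hmap : ∀ q, A.map (eval q) = normT₅ n p q r := by
    intro q
    ext i j
    simp [hAdef, normT₅, c, mul_div_assoc]
  have heval : ∀ q, eval q (pfaffian A) = pfaffian (normT₅ n p q r) := by
    intro q
    rw [← hmap, ← coe_evalRingHom, map_pfaffian]
  have hx : ∀ i j : Fin (2 * n), p ^ (i : ℕ) = p ^ (j : ℕ) → i = j := by
    intro i j hij
    have := zpow_inj_of_pow_ne_one (a := i) (b := j) hp h
      (by rw [zpow_natCast, zpow_natCast, hij]) (by rw [abs_lt]; omega)
    ext; omega
  obtain ⟨c', hc'⟩ := exists_eval_eq_of_pow_dvd (P := pfaffian A) (ι := Fin n × Fin n) hp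
    (e := fun y => (y.1 : ℤ) - y.2) (d := ∑ i : Fin n, (i : ℕ))
    (fun x y hxy => zpow_inj_of_pow_ne_one hp h hxy (by rw [abs_lt]; omega))
    (X_pow_dvd_pfaffian c)
    (fun x => (pow_dvd_pow _ (card_filter_sub_le _)).trans
      (pow_dvd_pfaffian (fun i j => by
          simp only [hAdef, Matrix.of_apply, hc i j]; ring)
        (fun i => by simp [hAdef]) _ (by rw [hmap]; exact rank_normT₅_le hp r hx _)))
    (by simpa using natDegree_pfaffian_le c)
  exact ⟨c', fun q => by rw [← heval, hc']⟩

/-! ### Products over pairs of indices -/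

theorem prod_Icc_one_eq {M : Type*} [CommMonoid M] (N : ℕ) (f : ℕ → M) :
    ∏ i ∈ Icc 1 N, f i = ∏ i : Fin N, f (i + 1) := by
  rw [Fin.prod_univ_eq_prod_range (fun i => f (i + 1)), Finset.range_eq_Ico,
    Finset.prod_Ico_add' f 0 N 1, zero_add]
  rfl

theorem prod_Icc_lt_eq {M : Type*} [CommMonoid M] (N : ℕ) (f : ℕ → ℕ → M) :
    ∏ i ∈ Icc 1 N, ∏ j ∈ Icc 1 N with i < j, f i j =
      ∏ i : Fin N, ∏ j : Fin N, if i < j then f (i + 1) (j + 1) else 1 := by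
  rw [prod_Icc_one_eq]
  refine Finset.prod_congr rfl fun i _ => ?_
  rw [Finset.prod_filter, prod_Icc_one_eq]
  refine Finset.prod_congr rfl fun j _ => ?_
  simp only [add_lt_add_iff_right, Fin.val_fin_lt]

/-- Each index occurs in `N - 1` pairs. -/
theorem prod_lt_mul_eq_pow {M : Type*} [CommMonoid M] {N : ℕ} (w : Fin N → M) :
    (∏ i, ∏ j, if i < j then w i * w j else 1) * ∏ i, w i = (∏ i, w i) ^ N := by
  have h1 : ∏ i, ∏ j, (if i < j then w i * w j else 1) =
      (∏ i, ∏ j, if i < j then w i else 1) * ∏ i, ∏ j, if j < i then w i else 1 := by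
    rw [Finset.prod_comm (f := fun i j => if j < i then w i else 1), ← Finset.prod_mul_distrib]
    refine Finset.prod_congr rfl fun i _ => ?_
    rw [← Finset.prod_mul_distrib]
    refine Finset.prod_congr rfl fun j _ => ?_
    split_ifs <;> simp
  have h2 : ∏ i, w i = ∏ i, ∏ j, if j = i then w i else 1 := by
    refine Finset.prod_congr rfl fun i _ => ?_
    simp
  rw [← Finset.prod_pow, h1, h2, ← Finset.prod_mul_distrib, ← Finset.prod_mul_distrib]
  refine Finset.prod_congr rfl fun i _ => ?_
  rw [← Finset.prod_mul_distrib, ← Finset.prod_mul_distrib]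
  calc _ = ∏ _j : Fin N, w i := by
        refine Finset.prod_congr rfl fun j _ => ?_
        rcases lt_trichotomy i j with h | rfl | h
        · simp [h, h.not_gt, h.ne']
        · simp
        · simp [h, h.not_gt, h.ne]
    _ = _ := by simp

theorem prod_lt_mul_distrib {M : Type*} [CommMonoid M] {N : ℕ} (f g : Fin N → Fin N → M) :
    (∏ i, ∏ j, if i < j then f i j * g i j else 1) =
      (∏ i, ∏ j, if i < j then f i j else 1) * ∏ i, ∏ j, if i < j then g i j else 1 := by
  rw [← Finset.prod_mul_distrib]
  refine Finset.prod_congr rfl fun i _ => ?_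
  rw [← Finset.prod_mul_distrib]
  refine Finset.prod_congr rfl fun j _ => ?_
  split_ifs <;> simp

/-- Splitting `0, …, 2n - 1` into two halves, the pairs within either half give the same product. -/
theorem prod_lt_fin_two_mul {M : Type*} [CommMonoid M] {n : ℕ} (f : ℤ → M) :
    (∏ i : Fin (2 * n), ∏ j : Fin (2 * n), if i < j then f ((j : ℤ) - i) else 1) =
      (∏ i : Fin n, ∏ j : Fin n, if i < j then f ((j : ℤ) - i) else 1) ^ 2 *
        ∏ y : Fin n × Fin n, f (n + ((y.2 : ℤ) - y.1)) := by
  have conv : ∀ N : ℕ, (∏ i : Fin N, ∏ j : Fin N, if i < j then f ((j : ℤ) - i) else 1) =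
      ∏ i ∈ range N, ∏ j ∈ range N, if i < j then f ((j : ℤ) - i) else 1 := by
    intro N
    rw [← Fin.prod_univ_eq_prod_range
      (fun i => ∏ j ∈ range N, if i < j then f ((j : ℤ) - i) else 1)]
    refine Finset.prod_congr rfl fun i _ => ?_
    rw [← Fin.prod_univ_eq_prod_range (fun j => if (i : ℕ) < j then f ((j : ℤ) - i) else 1)]
    rfl
  have hy : ∏ y : Fin n × Fin n, f (n + ((y.2 : ℤ) - y.1)) =
      ∏ i ∈ range n, ∏ j ∈ range n, f (n + ((j : ℤ) - i)) := by
    rw [Fintype.prod_prod_type, ← Fin.prod_univ_eq_prod_range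
      (fun i => ∏ j ∈ range n, f (n + ((j : ℤ) - i)))]
    refine Finset.prod_congr rfl fun i _ => ?_
    rw [← Fin.prod_univ_eq_prod_range (fun j => f (n + ((j : ℤ) - i)))]
  rw [conv, conv, hy, two_mul, Finset.prod_range_add]
  simp only [Finset.prod_range_add]
  have e1 : ∏ i ∈ range n, ((∏ j ∈ range n, if i < j then f ((j : ℤ) - i) else 1) *
      ∏ j ∈ range n, if i < n + j then f (((n + j : ℕ) : ℤ) - i) else 1) =
      (∏ i ∈ range n, ∏ j ∈ range n, if i < j then f ((j : ℤ) - i) else 1) *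
        ∏ i ∈ range n, ∏ j ∈ range n, f (n + ((j : ℤ) - i)) := by
    rw [Finset.prod_mul_distrib]
    congr 1
    refine Finset.prod_congr rfl fun i hi => Finset.prod_congr rfl fun j _ => ?_
    rw [Finset.mem_range] at hi
    rw [if_pos (by omega)]
    congr 1
    push_cast; ring
  have e2 : ∏ i ∈ range n, ((∏ j ∈ range n,
      if n + i < j then f ((j : ℤ) - ((n + i : ℕ) : ℤ)) else 1) *
      ∏ j ∈ range n, if n + i < n + j then f (((n + j : ℕ) : ℤ) - ((n + i : ℕ) : ℤ)) else 1) =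
      ∏ i ∈ range n, ∏ j ∈ range n, if i < j then f ((j : ℤ) - i) else 1 := by
    refine Finset.prod_congr rfl fun i _ => ?_
    rw [Finset.prod_eq_one, one_mul]
    · refine Finset.prod_congr rfl fun j _ => ?_
      simp only [add_lt_add_iff_left]
      congr 2
      push_cast; ring
    · intro j hj
      rw [Finset.mem_range] at hj
      exact if_neg (by omega)
  rw [e1, e2]
  rw [sq, mul_right_comm]

/-! ### Evaluation of the first Pfaffian -/

theorem γ_zpow_sub {K : Type*} [Field K] {s : K} (hs : s ≠ 0) (a b : ℕ) :
    γ (s ^ ((b : ℤ) - a)) = (s ^ a)⁻¹ * (s ^ b)⁻¹ * ((s ^ 2) ^ b - (s ^ 2) ^ a) := by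
  have h1 : s ^ a ≠ 0 := pow_ne_zero _ hs
  have h2 : s ^ b ≠ 0 := pow_ne_zero _ hs
  rw [γ, zpow_sub₀ hs, zpow_natCast, zpow_natCast, pow_right_comm s 2, pow_right_comm s 2]
  field_simp

theorem sq_pow_natAbs_eq_one_of_γ_eq_zero {K : Type*} [Field K] {s : K} (hs : s ≠ 0)
    {m : ℤ} (h : γ (s ^ m) = 0) : (s ^ 2) ^ m.natAbs = 1 := by
  have h0 : s ^ m ≠ 0 := zpow_ne_zero _ hs
  have h1 : s ^ m * s ^ m = 1 := by
    rw [γ, sub_eq_zero] at h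
    nth_rewrite 2 [h]
    exact mul_inv_cancel₀ h0
  have h2 : (s ^ 2) ^ m = 1 := by
    rw [← zpow_natCast s 2, ← zpow_mul, mul_comm, zpow_mul, zpow_natCast, sq, h1]
  obtain ⟨k, rfl | rfl⟩ := m.eq_nat_or_neg
  · simpa using h2
  · rw [zpow_neg, inv_eq_one] at h2
    simpa using h2

theorem γ_mul_zpow {K : Type*} [Field K] {s t : K} (hs : s ≠ 0) (ht : t ≠ 0) (m : ℤ) :
    γ (t * s ^ m) = t⁻¹ * s ^ m * (t ^ 2 - (s ^ 2) ^ (-m)) := by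
  have h0 : s ^ m ≠ 0 := zpow_ne_zero _ hs
  have h1 : (s ^ 2) ^ (-m) = (s ^ m)⁻¹ * (s ^ m)⁻¹ := by
    rw [← zpow_natCast s 2, ← zpow_mul, mul_comm, zpow_mul, zpow_natCast, zpow_neg]; ring
  rw [γ, h1]
  field_simp

theorem pfaffian_T₅_eq_mul {K : Type*} [Field K] {n : ℕ} {sp sq sr : K} (hp : sp ≠ 0)
    (hq : sq ≠ 0) (hr : sr ≠ 0) :
    pfaffian (T₅ n sp sq sr) = (sp * (sq * sr)⁻¹) ^ (∑ x : Fin (2 * n), (x : ℕ)) *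
      pfaffian (normT₅ n (sp ^ 2) (sq ^ 2) (sr ^ 2)) := by
  have h : T₅ n sp sq sr = Matrix.of fun i j : Fin (2 * n) =>
      (sp * (sq * sr)⁻¹) ^ (i : ℕ) * (sp * (sq * sr)⁻¹) ^ (j : ℕ) *
        normT₅ n (sp ^ 2) (sq ^ 2) (sr ^ 2) i j := by
    ext i j
    rw [T₅, normT₅, Matrix.of_apply, Matrix.of_apply, Matrix.of_apply]
    split_ifs with hij
    · subst hij; simp
    · have e : idx j - idx i = (j : ℤ) - i := by simp [idx]
      have := pow_ne_zero (i : ℕ) hp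
      have := pow_ne_zero (j : ℕ) hp
      rw [e, γ_zpow_sub hp, γ_zpow_sub hq,
        γ_zpow_sub hr, div_eq_mul_inv, mul_inv, mul_inv, mul_inv, inv_inv, inv_inv, mul_pow,
        mul_pow, inv_pow, inv_pow, mul_pow, mul_pow]
      simp only [div_eq_mul_inv]
      ring
  rw [h, pfaffian_diagonal_scaling, Finset.prod_pow_eq_pow_sum]

/-- The evaluation of `Pf T₅`, with rows and columns numbered from `0`. -/
theorem pfaffian_T₅_eq {K : Type*} [Field K] {n : ℕ} {sp sq sr : K} (hp : sp ≠ 0)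
    (hq : sq ≠ 0) (hr : sr ≠ 0) (h : ∀ k : ℕ, 1 ≤ k → k < 2 * n → (sp ^ 2) ^ k ≠ 1) :
    pfaffian (T₅ n sp sq sr) =
      ((∏ i : Fin n, ∏ j : Fin n, if i < j then γ (sp ^ ((j : ℤ) - i)) else 1) ^ 4 *
        ((∏ y : Fin n × Fin n, γ (sq * sp ^ ((y.2 : ℤ) - y.1))) *
          ∏ y : Fin n × Fin n, γ (sr * sp ^ ((y.2 : ℤ) - y.1)))) /
        ∏ i : Fin (2 * n), ∏ j : Fin (2 * n), if i < j then γ (sp ^ ((j : ℤ) - i)) else 1 := by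
  have hp2 : sp ^ 2 ≠ 0 := pow_ne_zero _ hp
  set N := ∑ x : Fin (2 * n), (x : ℕ) with hN
  set d := ∑ i : Fin n, (i : ℕ) with hd
  have hNd : N = 2 * d + n * n := sum_fin_two_mul n
  set κ : K := ∏ y : Fin n × Fin n, sp ^ ((y.2 : ℤ) - y.1) with hκ
  have hκ0 : κ ≠ 0 := Finset.prod_ne_zero_iff.mpr fun y _ => zpow_ne_zero _ hp
  set G : K → K := fun t => ∏ y : Fin n × Fin n, γ (t * sp ^ ((y.2 : ℤ) - y.1)) with hG
  set g : K → K := fun q => q ^ d * ∏ y : Fin n × Fin n, (q - (sp ^ 2) ^ ((y.1 : ℤ) - y.2)) with hg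
  set W := ∏ i : Fin (2 * n), ∏ j : Fin (2 * n), if i < j then γ (sp ^ ((j : ℤ) - i)) else 1
    with hW
  set H := ∏ i : Fin n, ∏ j : Fin n, if i < j then γ (sp ^ ((j : ℤ) - i)) else 1 with hH
  -- Both `G (q ^ (1/2))` and `g q` are the product of the factors that vanish at powers of `p`.
  have hgG : ∀ t, t ≠ 0 → κ * g (t ^ 2) = t ^ N * G t := by
    intro t ht
    have e : ∀ y : Fin n × Fin n, γ (t * sp ^ ((y.2 : ℤ) - y.1)) =
        t⁻¹ * sp ^ ((y.2 : ℤ) - y.1) * (t ^ 2 - (sp ^ 2) ^ ((y.1 : ℤ) - y.2)) := fun y => by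
      rw [γ_mul_zpow hp ht, neg_sub]
    simp only [hG, hg, e, Finset.prod_mul_distrib, Finset.prod_const, Finset.card_univ,
      Fintype.card_prod, Fintype.card_fin]
    rw [hNd, pow_add, pow_mul, inv_pow, ← hκ]
    have := pow_ne_zero (n * n) ht
    field_simp
  have hWH : W = H ^ 2 * G (sp ^ n) := by
    rw [hW, prod_lt_fin_two_mul (fun m => γ (sp ^ m)), ← hH]
    congr 1
    refine Finset.prod_congr rfl fun y _ => ?_
    rw [zpow_add₀ hp, zpow_natCast]
  have hW0 : W ≠ 0 := by
    refine Finset.prod_ne_zero_iff.mpr fun i _ => Finset.prod_ne_zero_iff.mpr fun j _ => ?_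
    split_ifs with hij
    · intro h0
      have hij' := Fin.lt_def.mp hij
      exact h _ (by omega) (by omega) (sq_pow_natAbs_eq_one_of_γ_eq_zero hp h0)
    · exact one_ne_zero
  have hG0 : G (sp ^ n) ≠ 0 := fun h0 => hW0 (by rw [hWH, h0, mul_zero])
  have hinj : Function.Injective fun i : Fin (2 * n) => (sp ^ 2) ^ (i : ℕ) := by
    intro i j hij
    have := zpow_inj_of_pow_ne_one (a := i) (b := j) hp2 h
      (by rw [zpow_natCast, zpow_natCast]; exact hij) (by rw [abs_lt]; omega)
    ext; omega
  -- At `q = r = pⁿ` the Pfaffian is a Vandermonde determinant.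
  have hbase : pfaffian (normT₅ n (sp ^ 2) ((sp ^ n) ^ 2) ((sp ^ n) ^ 2)) * sp ^ N =
      (sp ^ N) ^ (2 * n) * W := by
    have e1 : normT₅ n (sp ^ 2) ((sp ^ n) ^ 2) ((sp ^ n) ^ 2) = Matrix.of fun i j : Fin (2 * n) =>
        (((sp ^ 2) ^ (j : ℕ)) ^ n - ((sp ^ 2) ^ (i : ℕ)) ^ n) *
          (((sp ^ 2) ^ (j : ℕ)) ^ n - ((sp ^ 2) ^ (i : ℕ)) ^ n) /
            ((sp ^ 2) ^ (j : ℕ) - (sp ^ 2) ^ (i : ℕ)) := by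
      ext i j
      rw [normT₅, Matrix.of_apply, Matrix.of_apply, pow_right_comm sp n 2,
        pow_right_comm (sp ^ 2) n, pow_right_comm (sp ^ 2) n]
    have e2 : ∀ i j : Fin (2 * n), (sp ^ 2) ^ (j : ℕ) - (sp ^ 2) ^ (i : ℕ) =
        (sp ^ (i : ℕ) * sp ^ (j : ℕ)) * γ (sp ^ ((j : ℤ) - i)) := by
      intro i j
      have := pow_ne_zero (i : ℕ) hp
      have := pow_ne_zero (j : ℕ) hp
      rw [γ_zpow_sub hp]
      field_simp
    rw [e1, pfaffian_sq_div_sub hinj]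
    simp only [e2]
    rw [prod_lt_mul_distrib, ← hW, ← Finset.prod_pow_eq_pow_sum, mul_right_comm,
      prod_lt_mul_eq_pow]
  have hmain := mul_sq_eq_of_proportional (Φ := fun q r => pfaffian (normT₅ n (sp ^ 2) q r))
    (g := g) (fun q r => by rw [normT₅_swap]) (exists_pfaffian_normT₅_eq hp2 h)
    ((sp ^ n) ^ 2) (sq ^ 2) (sr ^ 2)
  have k0 := hgG _ (pow_ne_zero n hp)
  have k1 := hgG _ hq
  have k2 := hgG _ hr
  rw [pfaffian_T₅_eq_mul hp hq hr, ← hN, eq_div_iff hW0]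
  change _ = H ^ 4 * (G sq * G sr)
  generalize pfaffian (normT₅ n (sp ^ 2) (sq ^ 2) (sr ^ 2)) = F at *
  generalize pfaffian (normT₅ n (sp ^ 2) ((sp ^ n) ^ 2) ((sp ^ n) ^ 2)) = F₀ at *
  have ht : (sp ^ n) ^ N ≠ 0 := pow_ne_zero _ (pow_ne_zero _ hp)
  have ht' : (sp ^ N) ^ (2 * n) = ((sp ^ n) ^ N) ^ 2 := by
    rw [← pow_mul, ← pow_mul, ← pow_mul]; congr 1; ring
  rw [ht'] at hbase
  have hP := pow_ne_zero N hp
  have hQ := pow_ne_zero N hq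
  have hR := pow_ne_zero N hr
  have e1 : (sp * (sq * sr)⁻¹) ^ N = sp ^ N * (sq ^ N * sr ^ N)⁻¹ := by
    rw [mul_pow, inv_pow, mul_pow]
  rw [e1]
  generalize sp ^ N = P at *
  generalize sq ^ N = Q at *
  generalize sr ^ N = R at *
  generalize (sp ^ n) ^ N = T at *
  generalize G (sp ^ n) = G₀ at *
  generalize G sq = G₁ at *
  generalize G sr = G₂ at *
  generalize g ((sp ^ n) ^ 2) = g₀ at *
  generalize g (sq ^ 2) = g₁ at *
  generalize g (sr ^ 2) = g₂ at *
  have e2 : F * T ^ 2 * G₀ ^ 2 = F₀ * (Q * G₁ * (R * G₂)) := by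
    linear_combination κ ^ 2 * hmain - F * (κ * g₀ + T * G₀) * k0 + F₀ * (κ * g₂) * k1 +
      F₀ * (Q * G₁) * k2
  have e3 : F * P * G₀ ^ 2 = W * (Q * G₁ * (R * G₂)) := by
    refine mul_left_cancel₀ (pow_ne_zero 2 ht) ?_
    linear_combination P * e2 + (Q * G₁ * (R * G₂)) * hbase
  have e4 : F * P * W = H ^ 4 * (Q * G₁ * (R * G₂)) := by
    refine mul_left_cancel₀ (pow_ne_zero 2 hG0) ?_
    linear_combination W * e3 + (Q * G₁ * (R * G₂)) * (W + H ^ 2 * G₀) * hWH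
  field_simp
  linear_combination e4

/-! ### The second Pfaffian as a polynomial in `q` -/

/-- The numerator of the difference `(qᵃ⁺ᵇ - 1) / (pᵃ⁺ᵇ - 1) - (qᵇ - qᵃ) / (pᵇ - pᵃ)`, which occurs
once with `q` and once with `r` in an entry of `T₆`. -/
def diffNum {R : Type*} [CommRing R] (p q : R) (a b : ℕ) : R :=
  (q ^ (b + a) - 1) * (p ^ b - p ^ a) - (q ^ b - q ^ a) * (p ^ (b + a) - 1)

/-- The matrix `T₆` up to rescaling of rows and columns, with entries polynomial in `q` and
`r`. The diagonal entries are `0 / 0 = 0`. -/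
def normT₆ {K : Type*} [Field K] (n : ℕ) (p q r : K) : Matrix (Fin (2 * n)) (Fin (2 * n)) K :=
  Matrix.of fun i j => diffNum p q (i + 1) (j + 1) * diffNum p r (i + 1) (j + 1) /
    ((p ^ ((j + 1 : ℕ) + (i + 1 : ℕ)) - 1) * (p ^ (j + 1 : ℕ) - p ^ (i + 1 : ℕ)))

theorem diffNum_self {R : Type*} [CommRing R] (p q : R) (a : ℕ) : diffNum p q a a = 0 := by
  simp [diffNum]

theorem diffNum_swap {R : Type*} [CommRing R] (p q : R) (a b : ℕ) :
    diffNum p q b a = -diffNum p q a b := by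
  rw [diffNum, diffNum, add_comm a b]; ring

theorem diffNum_zero {R : Type*} [CommRing R] (p : R) (a b : ℕ) :
    diffNum p 0 (a + 1) (b + 1) = -(p ^ (b + 1) - p ^ (a + 1)) := by
  rw [diffNum, zero_pow (by omega), zero_pow (by omega), zero_pow (by omega)]; ring

/-- As a matrix in `a` and `b`, `diffNum p r` is antisymmetric of rank two. -/
theorem diffNum_eq {R : Type*} [CommRing R] (p r : R) (a b : ℕ) :
    diffNum p r a b =
      ((r * p) ^ b - 1) * (r ^ a - p ^ a) - (r ^ b - p ^ b) * ((r * p) ^ a - 1) := by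
  rw [diffNum]; ring

theorem diffNum_inv {K : Type*} [Field K] {q : K} (p : K) (hq : q ≠ 0) (a b : ℕ) :
    diffNum p q⁻¹ a b = -((q ^ a)⁻¹ * (q ^ b)⁻¹ * diffNum p q a b) := by
  have h1 := pow_ne_zero a hq
  have h2 := pow_ne_zero b hq
  rw [diffNum, diffNum, inv_pow, inv_pow, inv_pow, pow_add q]
  generalize p ^ (b + a) - 1 = u
  generalize p ^ b - p ^ a = v
  field_simp
  ring

theorem sum_range_eq_sum_half {M : Type*} [AddCommMonoid M] (k : ℕ) (h : ℕ → M)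
    (hmid : ∀ l, 2 * l + 1 = k → h l = 0) :
    ∑ l ∈ range k, h l = ∑ l ∈ range (k / 2), (h l + h (k - 1 - l)) := by
  obtain ⟨m, rfl | rfl⟩ := Nat.even_or_odd' k
  · rw [show 2 * m / 2 = m by omega, Finset.sum_add_distrib]
    nth_rewrite 1 [two_mul]
    rw [Finset.sum_range_add, ← Finset.sum_range_reflect (fun l => h (m + l))]
    congr 1
    refine Finset.sum_congr rfl fun l hl => ?_
    rw [Finset.mem_range] at hl
    congr 1; omega
  · rw [show (2 * m + 1) / 2 = m by omega, Finset.sum_add_distrib,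
      show 2 * m + 1 = (m + 1) + m by ring, Finset.sum_range_add, Finset.sum_range_succ,
      hmid m rfl, add_zero, ← Finset.sum_range_reflect (fun l => h (m + 1 + l))]
    congr 1
    refine Finset.sum_congr rfl fun l hl => ?_
    rw [Finset.mem_range] at hl
    congr 1; omega

/-- Pairing `l` with `k - 1 - l` exhibits the difference of the two geometric sums, as a matrix in
`x` and `y`, as a symmetric matrix of rank at most `k / 2`. -/
theorem geom_sum_sub_geom_sum₂ {R : Type*} [CommRing R] (x y : R) (k : ℕ) :
    ∑ l ∈ range k, (x * y) ^ l - ∑ l ∈ range k, x ^ l * y ^ (k - 1 - l) =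
      ∑ l ∈ range (k / 2), (x ^ l - x ^ (k - 1 - l)) * (y ^ l - y ^ (k - 1 - l)) := by
  rw [← Finset.sum_sub_distrib, sum_range_eq_sum_half]
  · refine Finset.sum_congr rfl fun l hl => ?_
    rw [Finset.mem_range] at hl
    rw [show k - 1 - (k - 1 - l) = l by omega, mul_pow, mul_pow]
    ring
  · intro l hl
    rw [show k - 1 - l = l by omega, mul_pow, sub_self]

theorem diffNum_pow {R : Type*} [CommRing R] (p : R) (k a b : ℕ) :
    diffNum p (p ^ k) a b = (p ^ (b + a) - 1) * (p ^ b - p ^ a) *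
      ∑ l ∈ range (k / 2), ((p ^ b) ^ l - (p ^ b) ^ (k - 1 - l)) *
        ((p ^ a) ^ l - (p ^ a) ^ (k - 1 - l)) := by
  have h1 := geom_sum_mul (p ^ b * p ^ a) k
  have h2 := geom_sum₂_mul (p ^ b) (p ^ a) k
  rw [← geom_sum_sub_geom_sum₂, diffNum, pow_right_comm p k b, pow_right_comm p k a,
    pow_right_comm p k (b + a), pow_add p]
  linear_combination (-(p ^ b - p ^ a)) * h1 + (p ^ b * p ^ a - 1) * h2

/-- At `q = p ^ k`, the factor that depends on `q` is symmetric of rank at most `k / 2` and the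
other one is antisymmetric of rank two, so that their entrywise product has rank at
most `2 * (k / 2)`. -/
theorem rank_normT₆_le {K : Type*} [Field K] {n : ℕ} {p : K} (hp : p ≠ 0) (r : K)
    (hx : ∀ i j : Fin (2 * n), i ≠ j → p ^ (i + 1 : ℕ) ≠ p ^ (j + 1 : ℕ))
    (hx' : ∀ i j : Fin (2 * n), i ≠ j → p ^ ((j + 1 : ℕ) + (i + 1 : ℕ)) ≠ 1) (m : ℤ) :
    (normT₆ n p (p ^ m) r).rank ≤ 2 * (m.natAbs / 2) := by
  let s : ℕ → ℕ → Fin (2 * n) → K := fun k l i =>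
    (p ^ (i + 1 : ℕ)) ^ l - (p ^ (i + 1 : ℕ)) ^ (k - 1 - l)
  let f : Fin (2 * n) → K := fun i => (r * p) ^ (i + 1 : ℕ) - 1
  let g : Fin (2 * n) → K := fun i => r ^ (i + 1 : ℕ) - p ^ (i + 1 : ℕ)
  have key : ∀ (k : ℕ) (i j : Fin (2 * n)), normT₆ n p (p ^ k) r i j =
      ∑ l : Fin (k / 2),
        ((s k l i * g i) * (s k l j * f j) - (s k l i * f i) * (s k l j * g j)) := by
    intro k i j
    rw [normT₆, Matrix.of_apply]
    rcases eq_or_ne i j with rfl | hij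
    · simp only [diffNum_self, zero_mul, zero_div]
      exact (Finset.sum_eq_zero fun l _ => by ring).symm
    · have h1 := sub_ne_zero.mpr (hx' i j hij)
      have h2 := sub_ne_zero.mpr (hx i j hij).symm
      rw [diffNum_pow, mul_right_comm, mul_assoc, mul_div_cancel_left₀ _ (mul_ne_zero h1 h2),
        mul_comm, Finset.sum_mul, diffNum_eq, Finset.sum_range]
      refine Finset.sum_congr rfl fun l _ => ?_
      simp only [s, f, g]
      ring
  obtain ⟨k, rfl | rfl⟩ := m.eq_nat_or_neg
  · rw [Int.natAbs_natCast, zpow_natCast]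
    exact rank_le_two_mul _ _ (key k)
  · rw [Int.natAbs_neg, Int.natAbs_natCast, zpow_neg, zpow_natCast]
    refine rank_le_two_mul (k := k / 2)
      (fun l i => ((p ^ k) ^ (i + 1 : ℕ))⁻¹ * (s k l i * f i))
      (fun l j => ((p ^ k) ^ (j + 1 : ℕ))⁻¹ * (s k l j * g j)) fun i j => ?_
    have e : normT₆ n p (p ^ k)⁻¹ r i j = -(((p ^ k) ^ (i + 1 : ℕ))⁻¹ *
        ((p ^ k) ^ (j + 1 : ℕ))⁻¹ * normT₆ n p (p ^ k) r i j) := by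
      rw [normT₆, normT₆, Matrix.of_apply, Matrix.of_apply, diffNum_inv _ (pow_ne_zero _ hp)]
      ring
    rw [e, key, Finset.mul_sum, ← Finset.sum_neg_distrib]
    exact Finset.sum_congr rfl fun l _ => by ring

theorem normT₆_swap {K : Type*} [Field K] (n : ℕ) (p q r : K) :
    normT₆ n p q r = normT₆ n p r q := by
  ext i j
  rw [normT₆, normT₆, Matrix.of_apply, Matrix.of_apply, mul_comm (diffNum p q _ _)]

theorem sum_fin_two_mul_add_one (n : ℕ) : ∑ x : Fin (2 * n), ((x : ℕ) + 1) = (2 * n + 1) * n := by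
  rw [Fin.sum_univ_eq_sum_range (fun x => x + 1), Finset.sum_add_distrib]
  have h := Finset.sum_range_id_mul_two (2 * n)
  simp only [Finset.sum_const, Finset.card_range, smul_eq_mul]
  rcases n with _ | n
  · simp
  · rw [show 2 * (n + 1) - 1 = 2 * n + 1 by omega] at h
    linarith

/-- The exponents of the powers of `p` at which `Pf T₆` vanishes: the differences `i - j` with
`1 ≤ i, j ≤ 2n + 1` and `j` even, the pair `y` standing for `i = y.1 + 1` and `j = 2 (y.2 + 1)`. -/
def zeroExp {n : ℕ} (y : Fin (2 * n + 1) × Fin n) : ℤ := (y.1 : ℤ) + 1 - 2 * ((y.2 : ℤ) + 1)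

theorem card_filter_zeroExp_le {n : ℕ} (m : ℤ) :
    (univ.filter fun y : Fin (2 * n + 1) × Fin n => zeroExp y = m).card ≤ n - m.natAbs / 2 := by
  rw [← Finset.card_range (n - m.natAbs / 2)]
  refine Finset.card_le_card_of_injOn (fun y => if 0 ≤ m then (y.2 : ℕ) else n - 1 - y.2) ?_ ?_
  · intro y hy
    have : zeroExp y = m := by simpa using hy
    rw [zeroExp] at this
    simp only [coe_range, Set.mem_Iio]
    split_ifs <;> omega
  · rintro ⟨a, b⟩ hx ⟨a', b'⟩ hy hxy
    have h1 : zeroExp (a, b) = m := by simpa using hx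
    have h2 : zeroExp (a', b') = m := by simpa using hy
    simp only [zeroExp] at h1 h2
    simp only at hxy
    split_ifs at hxy <;> ext <;> simp only <;> omega

open Polynomial in
theorem natDegree_diffNum_le {K : Type*} [Field K] (p : K) (a b : ℕ) :
    (diffNum (C p) X a b).natDegree ≤ a + b := by
  have h1 : diffNum (C p) X a b = (X ^ (b + a) - 1) * C (p ^ b - p ^ a) -
      (X ^ b - X ^ a) * C (p ^ (b + a) - 1) := by
    rw [diffNum]; simp
  have h2 := natDegree_sub_le (X ^ (b + a) : K[X]) 1
  have h3 := natDegree_sub_le (X ^ b : K[X]) (X ^ a)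
  rw [natDegree_X_pow, natDegree_one] at h2
  rw [natDegree_X_pow, natDegree_X_pow] at h3
  rw [h1]
  refine (natDegree_sub_le _ _).trans (max_le ?_ ?_)
  · exact (natDegree_mul_C_le _ _).trans (h2.trans (max_le (by omega) (by omega)))
  · exact (natDegree_mul_C_le _ _).trans (h3.trans (max_le (by omega) (by omega)))

open Polynomial in
theorem natDegree_pfaffian_le_sum {K : Type*} [Field K] {n : ℕ}
    {A : Matrix (Fin (2 * n)) (Fin (2 * n)) K[X]} {d : Fin (2 * n) → ℕ}
    (hA : ∀ i j, (A i j).natDegree ≤ d i + d j) : (pfaffian A).natDegree ≤ ∑ x, d x := by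
  refine natDegree_sum_le_of_forall_le _ _ fun π _ => ?_
  rw [← C_eq_intCast]
  refine (natDegree_C_mul_le _ _).trans ((natDegree_prod_le _ _).trans ?_)
  rw [← Equiv.sum_comp π d, ← (posEquiv n).sum_comp, Fintype.sum_prod_type]
  refine Finset.sum_le_sum fun i _ => (hA _ _).trans ?_
  simp [add_comm]

open Polynomial in
/-- The zeros at the powers of `p` exhaust the degree. -/
theorem exists_pfaffian_normT₆_eq {K : Type*} [Field K] {n : ℕ} {p : K} (hp : p ≠ 0)
    (h : ∀ k, 1 ≤ k → k < 4 * n → p ^ k ≠ 1) (r : K) :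
    ∃ c, ∀ q, pfaffian (normT₆ n p q r) =
      c * ∏ y : Fin (2 * n + 1) × Fin n, (q - p ^ zeroExp y) := by
  let c : Fin (2 * n) → Fin (2 * n) → K := fun i j => diffNum p r (i + 1) (j + 1) /
    ((p ^ ((j + 1 : ℕ) + (i + 1 : ℕ)) - 1) * (p ^ (j + 1 : ℕ) - p ^ (i + 1 : ℕ)))
  have hc : ∀ i j, c j i = c i j := fun i j => by
    simp only [c]
    rw [diffNum_swap, ← neg_sub (p ^ (j + 1 : ℕ)), mul_neg, neg_div_neg_eq,
      add_comm (j + 1 : ℕ)]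
  set A : Matrix (Fin (2 * n)) (Fin (2 * n)) K[X] :=
    Matrix.of fun i j => diffNum (C p) X (i + 1) (j + 1) * C (c i j) with hAdef
  have hmap : ∀ q, A.map (eval q) = normT₆ n p q r := by
    intro q
    ext i j
    simp [hAdef, normT₆, c, mul_div_assoc, diffNum]
  have heval : ∀ q, eval q (pfaffian A) = pfaffian (normT₆ n p q r) := by
    intro q
    rw [← hmap, ← coe_evalRingHom, map_pfaffian]
  have hx : ∀ i j : Fin (2 * n), i ≠ j → p ^ (i + 1 : ℕ) ≠ p ^ (j + 1 : ℕ) := by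
    intro i j hne hij
    have := zpow_inj_of_pow_ne_one (a := (i + 1 : ℕ)) (b := (j + 1 : ℕ)) hp h
      (by rw [zpow_natCast, zpow_natCast, hij]) (by rw [abs_lt]; omega)
    exact hne (by ext; omega)
  have hx' : ∀ i j : Fin (2 * n), i ≠ j → p ^ ((j + 1 : ℕ) + (i + 1 : ℕ)) ≠ 1 := by
    intro i j hne
    have : (i : ℕ) ≠ j := fun h => hne (by ext; exact h)
    exact h _ (by omega) (by omega)
  have hdeg : (pfaffian A).natDegree ≤ (2 * n + 1) * n := by
    rw [← sum_fin_two_mul_add_one]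
    refine natDegree_pfaffian_le_sum (d := fun x => (x : ℕ) + 1) fun i j => ?_
    rw [hAdef, Matrix.of_apply]
    exact (natDegree_mul_C_le _ _).trans (natDegree_diffNum_le _ _ _)
  obtain ⟨c', hc'⟩ := exists_eval_eq_of_pow_dvd (P := pfaffian A) hp
    (e := zeroExp (n := n)) (d := 0)
    (fun x y hxy => zpow_inj_of_pow_ne_one hp h hxy (by
      rw [abs_lt]; simp only [zeroExp]; omega))
    (by simp)
    (fun x => (pow_dvd_pow _ (card_filter_zeroExp_le _)).trans
      (pow_dvd_pfaffian (fun i j => by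
          simp only [hAdef, Matrix.of_apply, hc i j]
          rw [diffNum_swap, neg_mul])
        (fun i => by simp [hAdef, diffNum_self]) _
        (by rw [hmap]; exact rank_normT₆_le hp r hx hx' _)))
    (by simpa using hdeg)
  exact ⟨c', fun q => by rw [← heval, hc', pow_zero, one_mul]⟩

/-! ### Evaluation of the second Pfaffian -/

theorem γ_zpow_add {K : Type*} [Field K] {s : K} (hs : s ≠ 0) (a b : ℕ) :
    γ (s ^ ((b : ℤ) + a)) = (s ^ a)⁻¹ * (s ^ b)⁻¹ * ((s ^ 2) ^ (b + a) - 1) := by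
  have h1 : s ^ a ≠ 0 := pow_ne_zero _ hs
  have h2 : s ^ b ≠ 0 := pow_ne_zero _ hs
  rw [γ, zpow_add₀ hs, zpow_natCast, zpow_natCast, pow_right_comm s 2, pow_add]
  field_simp

theorem γ_mul_γ_sub {K : Type*} [Field K] {s t : K} (hs : s ≠ 0) (ht : t ≠ 0) (a b : ℕ) :
    γ (t ^ ((b : ℤ) + a)) * γ (s ^ ((b : ℤ) - a)) - γ (t ^ ((b : ℤ) - a)) * γ (s ^ ((b : ℤ) + a)) =
      (t ^ a)⁻¹ * (t ^ b)⁻¹ * ((s ^ a)⁻¹ * (s ^ b)⁻¹) * diffNum (s ^ 2) (t ^ 2) a b := by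
  rw [γ_zpow_add ht, γ_zpow_add hs, γ_zpow_sub ht, γ_zpow_sub hs, diffNum]
  ring

theorem pfaffian_T₆_eq_mul {K : Type*} [Field K] {n : ℕ} {sp sq sr : K} (hp : sp ≠ 0)
    (hq : sq ≠ 0) (hr : sr ≠ 0) (h : ∀ k : ℕ, 1 ≤ k → k < 4 * n → (sp ^ 2) ^ k ≠ 1) :
    pfaffian (T₆ n sp sq sr) = ((sq * sr)⁻¹) ^ ((2 * n + 1) * n) *
      pfaffian (normT₆ n (sp ^ 2) (sq ^ 2) (sr ^ 2)) := by
  have e : T₆ n sp sq sr = Matrix.of fun i j : Fin (2 * n) =>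
      ((sq * sr)⁻¹) ^ (i + 1 : ℕ) * ((sq * sr)⁻¹) ^ (j + 1 : ℕ) *
        normT₆ n (sp ^ 2) (sq ^ 2) (sr ^ 2) i j := by
    ext i j
    rw [T₆, normT₆, Matrix.of_apply, Matrix.of_apply, Matrix.of_apply]
    split_ifs with hij
    · subst hij; simp [diffNum_self]
    · have hne : (i : ℕ) ≠ j := fun h => hij (by ext; exact h)
      have hi : idx i = ((i + 1 : ℕ) : ℤ) := by simp [idx]
      have hj : idx j = ((j + 1 : ℕ) : ℤ) := by simp [idx]
      have g1 : γ (sp ^ (((j + 1 : ℕ) : ℤ) + ((i + 1 : ℕ) : ℤ))) ≠ 0 := fun h0 =>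
        h _ (by omega) (by omega) (sq_pow_natAbs_eq_one_of_γ_eq_zero hp h0)
      have g2 : γ (sp ^ (((j + 1 : ℕ) : ℤ) - ((i + 1 : ℕ) : ℤ))) ≠ 0 := fun h0 =>
        h _ (by omega) (by omega) (sq_pow_natAbs_eq_one_of_γ_eq_zero hp h0)
      have d1 := γ_mul_γ_sub hp hq (i + 1) (j + 1)
      have d2 := γ_mul_γ_sub hp hr (i + 1) (j + 1)
      have d3 := γ_zpow_add hp (i + 1) (j + 1)
      have d4 := γ_zpow_sub hp (i + 1) (j + 1)
      have s1 := pow_ne_zero (i + 1 : ℕ) hp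
      have s2 := pow_ne_zero (j + 1 : ℕ) hp
      rw [hi, hj, div_sub_div _ _ g1 g2, div_sub_div _ _ g1 g2]
      rw [mul_comm (γ (sp ^ (((j + 1 : ℕ) : ℤ) + ((i + 1 : ℕ) : ℤ)))) (γ (sq ^ _)),
        mul_comm (γ (sp ^ (((j + 1 : ℕ) : ℤ) + ((i + 1 : ℕ) : ℤ)))) (γ (sr ^ _)), d1, d2]
      have e1 : ∀ x y u v : K, x ≠ 0 → y ≠ 0 → x * y * (u / (x * y)) * (v / (x * y)) =
          u * v / (x * y) := by
        intro x y u v hx hy; field_simp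
      rw [e1 _ _ _ _ g1 g2, d3, d4, inv_pow, inv_pow, mul_pow, mul_pow]
      rw [d3] at g1
      rw [d4] at g2
      have g1' := right_ne_zero_of_mul g1
      have g2' := right_ne_zero_of_mul g2
      generalize (sp ^ 2) ^ ((j : ℕ) + 1 + (i + 1)) - 1 = u at *
      generalize (sp ^ 2) ^ ((j : ℕ) + 1) - (sp ^ 2) ^ ((i : ℕ) + 1) = v at *
      field_simp
  rw [e, pfaffian_diagonal_scaling, Finset.prod_pow_eq_pow_sum, sum_fin_two_mul_add_one]

/-- Reversing both indices changes the sign of `zeroExp`. -/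
theorem prod_zpow_zeroExp {K : Type*} [Field K] {s : K} (hs : s ≠ 0) (n : ℕ) :
    (∏ y : Fin (2 * n + 1) × Fin n, s ^ (-zeroExp y)) ^ 2 = 1 := by
  have h : ∏ y : Fin (2 * n + 1) × Fin n, s ^ (-zeroExp y) =
      ∏ y : Fin (2 * n + 1) × Fin n, s ^ zeroExp y := by
    refine Fintype.prod_equiv (Fin.revPerm.prodCongr Fin.revPerm) _ _ fun y => ?_
    congr 1
    obtain ⟨a, b⟩ := y
    change -(((a : ℕ) : ℤ) + 1 - 2 * (((b : ℕ) : ℤ) + 1)) =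
      ((a.rev : ℕ) : ℤ) + 1 - 2 * (((b.rev : ℕ) : ℤ) + 1)
    rw [Fin.val_rev, Fin.val_rev]
    omega
  rw [sq]
  nth_rewrite 2 [h]
  rw [← Finset.prod_mul_distrib]
  exact Finset.prod_eq_one fun y _ => by rw [zpow_neg, inv_mul_cancel₀ (zpow_ne_zero _ hs)]

/-- The evaluation of `Pf T₆`, with the rows and columns numbered from `0`. -/
theorem pfaffian_T₆_eq {K : Type*} [Field K] {n : ℕ} {sp sq sr : K} (hp : sp ≠ 0)
    (hq : sq ≠ 0) (hr : sr ≠ 0) (h : ∀ k : ℕ, 1 ≤ k → k < 4 * n → (sp ^ 2) ^ k ≠ 1) :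
    pfaffian (T₆ n sp sq sr) =
      (∏ i : Fin (2 * n), ∏ j : Fin (2 * n), if i < j then γ (sp ^ ((j : ℤ) - i)) /
          γ (sp ^ (((j + 1 : ℕ) : ℤ) + ((i + 1 : ℕ) : ℤ))) else 1) *
        ((∏ y : Fin (2 * n + 1) × Fin n, γ (sq * sp ^ (-zeroExp y))) *
          ∏ y : Fin (2 * n + 1) × Fin n, γ (sr * sp ^ (-zeroExp y))) := by
  have hp2 : sp ^ 2 ≠ 0 := pow_ne_zero _ hp
  set κ : K := ∏ y : Fin (2 * n + 1) × Fin n, sp ^ (-zeroExp y) with hκ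
  have hκ2 : κ ^ 2 = 1 := prod_zpow_zeroExp hp n
  set G : K → K := fun t => ∏ y : Fin (2 * n + 1) × Fin n, γ (t * sp ^ (-zeroExp y)) with hG
  set g : K → K := fun q => ∏ y : Fin (2 * n + 1) × Fin n, (q - (sp ^ 2) ^ zeroExp y) with hg
  -- Both `G (q ^ (1/2))` and `g q` are the product of the factors that vanish at powers of `p`.
  have hgG : ∀ t, t ≠ 0 → κ * g (t ^ 2) = t ^ ((2 * n + 1) * n) * G t := by
    intro t ht
    have e : ∀ y : Fin (2 * n + 1) × Fin n, γ (t * sp ^ (-zeroExp y)) =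
        t⁻¹ * sp ^ (-zeroExp y) * (t ^ 2 - (sp ^ 2) ^ zeroExp y) := fun y => by
      rw [γ_mul_zpow hp ht, neg_neg]
    simp only [hG, hg, e, Finset.prod_mul_distrib, Finset.prod_const, Finset.card_univ,
      Fintype.card_prod, Fintype.card_fin]
    rw [inv_pow, ← hκ]
    have := pow_ne_zero ((2 * n + 1) * n) ht
    field_simp
  have hg0 : g 0 ^ 2 = 1 := by
    have e : g 0 ^ 2 * (κ ^ 2) ^ 2 = 1 := by
      rw [← mul_pow, hg, hκ, ← Finset.prod_pow, ← Finset.prod_mul_distrib, ← Finset.prod_pow]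
      refine Finset.prod_eq_one fun y _ => ?_
      have : (sp ^ 2) ^ zeroExp y = (sp ^ zeroExp y) ^ 2 := by
        rw [← zpow_natCast, ← zpow_natCast, ← zpow_mul, ← zpow_mul, mul_comm]
      have h0 := zpow_ne_zero (zeroExp y) hp
      rw [this, zpow_neg]
      field_simp
      ring
    rwa [hκ2, one_pow, mul_one] at e
  -- At `q = r = 0` the Pfaffian is Schur's.
  have hbase : pfaffian (normT₆ n (sp ^ 2) 0 0) = ∏ i : Fin (2 * n), ∏ j : Fin (2 * n),
      if i < j then γ (sp ^ ((j : ℤ) - i)) /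
          γ (sp ^ (((j + 1 : ℕ) : ℤ) + ((i + 1 : ℕ) : ℤ))) else 1 := by
    have e1 : normT₆ n (sp ^ 2) 0 0 = Matrix.of fun i j : Fin (2 * n) =>
        ((sp ^ 2) ^ (j + 1 : ℕ) - (sp ^ 2) ^ (i + 1 : ℕ)) /
          ((sp ^ 2) ^ (i + 1 : ℕ) * (sp ^ 2) ^ (j + 1 : ℕ) - 1) := by
      ext i j
      rw [normT₆, Matrix.of_apply, Matrix.of_apply, diffNum_zero, neg_mul_neg, ← pow_add,
        add_comm (i + 1 : ℕ)]
      rcases eq_or_ne ((sp ^ 2) ^ (j + 1 : ℕ) - (sp ^ 2) ^ (i + 1 : ℕ)) 0 with h0 | h0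
      · rw [h0]; simp
      · rw [mul_div_mul_right _ _ h0]
    rw [e1, pfaffian_schur]
    · refine Finset.prod_congr rfl fun i _ => Finset.prod_congr rfl fun j _ => ?_
      congr 1
      have e2 : (j : ℤ) - i = ((j + 1 : ℕ) : ℤ) - ((i + 1 : ℕ) : ℤ) := by push_cast; ring
      have s1 := pow_ne_zero (i + 1 : ℕ) hp
      have s2 := pow_ne_zero (j + 1 : ℕ) hp
      rw [e2, γ_zpow_sub hp, γ_zpow_add hp, mul_div_mul_left _ _
        (mul_ne_zero (inv_ne_zero s1) (inv_ne_zero s2)), ← pow_add, add_comm (i + 1 : ℕ)]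
    · intro i j hne hij
      have := zpow_inj_of_pow_ne_one (a := (i + 1 : ℕ)) (b := (j + 1 : ℕ)) hp2 h
        (by rw [zpow_natCast, zpow_natCast, hij]) (by rw [abs_lt]; omega)
      exact hne (by ext; omega)
    · intro i j hne
      have : (i : ℕ) ≠ j := fun h => hne (by ext; exact h)
      rw [← pow_add]
      exact h _ (by omega) (by omega)
  have hmain := mul_sq_eq_of_proportional (Φ := fun q r => pfaffian (normT₆ n (sp ^ 2) q r))
    (g := g) (fun q r => by rw [normT₆_swap]) (exists_pfaffian_normT₆_eq hp2 h)
    0 (sq ^ 2) (sr ^ 2)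
  rw [hg0, mul_one] at hmain
  rw [pfaffian_T₆_eq_mul hp hq hr h, hmain, hbase, inv_pow, mul_pow,
    inv_mul_eq_iff_eq_mul₀ (mul_ne_zero (pow_ne_zero _ hq) (pow_ne_zero _ hr))]
  have k1 := hgG _ hq
  have k2 := hgG _ hr
  rw [← one_mul (g (sq ^ 2) * g (sr ^ 2)), ← hκ2]
  change _ * (κ ^ 2 * (g (sq ^ 2) * g (sr ^ 2))) = _ * (_ * (G sq * G sr))
  rw [show κ ^ 2 * (g (sq ^ 2) * g (sr ^ 2)) = (κ * g (sq ^ 2)) * (κ * g (sr ^ 2)) by ring, k1, k2]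
  ring

theorem prod_Icc_even_eq {M : Type*} [CommMonoid M] (n : ℕ) (f : ℕ → M) :
    ∏ j ∈ Icc 1 (2 * n + 1) with 2 ∣ j, f j = ∏ j : Fin n, f (2 * (j + 1)) := by
  symm
  refine Finset.prod_bij (fun j _ => 2 * ((j : ℕ) + 1)) ?_ ?_ ?_ ?_
  · intro j _
    rw [Finset.mem_filter, Finset.mem_Icc]
    exact ⟨⟨by omega, by omega⟩, dvd_mul_right _ _⟩
  · intro i _ j _ hij
    ext; omega
  · intro b hb
    rw [Finset.mem_filter, Finset.mem_Icc] at hb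
    exact ⟨⟨b / 2 - 1, by omega⟩, Finset.mem_univ _, by simp only; omega⟩
  · intro j _; rfl

end RoundPfaffian

theorem mainTheorem7 {K : Type*} [Field K] (n : ℕ) (p q r sp sq sr : K)
    (hp : p ≠ 0) (hq : q ≠ 0) (hr : r ≠ 0)
    (hsp : sp ^ 2 = p) (hsq : sq ^ 2 = q) (hsr : sr ^ 2 = r) :
    ((∀ k : ℕ, 1 ≤ k → k < 2 * n → p ^ k ≠ 1) →
      RoundPfaffian.pfaffian (RoundPfaffian.T₅ n sp sq sr) =
        ((∏ i ∈ Finset.Icc 1 n, ∏ j ∈ Finset.Icc 1 n with i < j,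
              RoundPfaffian.γ (sp ^ ((j : ℤ) - (i : ℤ))) ^ 4) *
            ∏ i ∈ Finset.Icc 1 n, ∏ j ∈ Finset.Icc 1 n,
              RoundPfaffian.γ (sq * sp ^ ((j : ℤ) - (i : ℤ))) *
                RoundPfaffian.γ (sr * sp ^ ((j : ℤ) - (i : ℤ)))) /
          ∏ i ∈ Finset.Icc 1 (2 * n), ∏ j ∈ Finset.Icc 1 (2 * n) with i < j,
            RoundPfaffian.γ (sp ^ ((j : ℤ) - (i : ℤ)))) ∧
    ((∀ k : ℕ, 1 ≤ k → k < 4 * n → p ^ k ≠ 1) →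
      RoundPfaffian.pfaffian (RoundPfaffian.T₆ n sp sq sr) =
        ((∏ i ∈ Finset.Icc 1 (2 * n), ∏ j ∈ Finset.Icc 1 (2 * n) with i < j,
              RoundPfaffian.γ (sp ^ ((j : ℤ) - (i : ℤ)))) *
            ∏ i ∈ Finset.Icc 1 (2 * n + 1), ∏ j ∈ Finset.Icc 1 (2 * n + 1) with 2 ∣ j,
              RoundPfaffian.γ (sq * sp ^ ((j : ℤ) - (i : ℤ))) *
                RoundPfaffian.γ (sr * sp ^ ((j : ℤ) - (i : ℤ)))) /
          ∏ i ∈ Finset.Icc 1 (2 * n), ∏ j ∈ Finset.Icc 1 (2 * n) with i < j,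
            RoundPfaffian.γ (sp ^ ((j : ℤ) + (i : ℤ)))) := by
  subst hsp hsq hsr
  have hp' : sp ≠ 0 := fun h => hp (by rw [h]; ring)
  have hq' : sq ≠ 0 := fun h => hq (by rw [h]; ring)
  have hr' : sr ≠ 0 := fun h => hr (by rw [h]; ring)
  have hsub : ∀ a b : ℕ, ((b + 1 : ℕ) : ℤ) - ((a + 1 : ℕ) : ℤ) = (b : ℤ) - a := fun a b => by
    push_cast; ring
  refine ⟨fun h => ?_, fun h => ?_⟩
  · rw [RoundPfaffian.pfaffian_T₅_eq hp' hq' hr' h, RoundPfaffian.prod_Icc_lt_eq,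
      RoundPfaffian.prod_Icc_lt_eq, RoundPfaffian.prod_Icc_one_eq]
    simp only [RoundPfaffian.prod_Icc_one_eq, hsub, Fintype.prod_prod_type,
      Finset.prod_mul_distrib]
    congr 2
    rw [← Finset.prod_pow]
    refine Finset.prod_congr rfl fun i _ => ?_
    rw [← Finset.prod_pow]
    refine Finset.prod_congr rfl fun j _ => ?_
    split_ifs <;> simp
  · rw [RoundPfaffian.pfaffian_T₆_eq hp' hq' hr' h, RoundPfaffian.prod_Icc_lt_eq,
      RoundPfaffian.prod_Icc_lt_eq, RoundPfaffian.prod_Icc_one_eq]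
    simp only [RoundPfaffian.prod_Icc_even_eq, hsub, div_eq_mul_inv,
      RoundPfaffian.prod_lt_mul_distrib, Fintype.prod_prod_type, Finset.prod_mul_distrib]
    have e1 : ∀ (i : Fin (2 * n + 1)) (j : Fin n), -RoundPfaffian.zeroExp (i, j) =
        ((2 * ((j : ℕ) + 1) : ℕ) : ℤ) - (((i : ℕ) + 1 : ℕ) : ℤ) := fun i j => by
      simp only [RoundPfaffian.zeroExp]; push_cast; ring
    have e2 : ∀ f : Fin (2 * n) → Fin (2 * n) → K, (∏ i, ∏ j, if i < j then (f i j)⁻¹ else 1) =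
        (∏ i, ∏ j, if i < j then f i j else 1)⁻¹ := fun f => by
      rw [← Finset.prod_inv_distrib]
      refine Finset.prod_congr rfl fun i _ => ?_
      rw [← Finset.prod_inv_distrib]
      refine Finset.prod_congr rfl fun j _ => ?_
      split_ifs <;> simp
    simp only [e1]
    rw [e2]
    ring
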